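/- Let $a\in\mathbb R$, $\varepsilon>0$ and $R>0$ with $27R^6>4|a|^3$, and put $\alpha=e^{2\pi i/3}$. Let $\nu$ be the function, holomorphic on $\{27|\lambda|^6>4|a|^3\}\supset\{|\lambda|\ge R\}$, with $\nu(\lambda)^3-a\nu(\lambda)=\lambda^3$ and $\nu(\lambda)=\lambda+O(\lambda^{-1})$ as $\lambda\to\infty$. Let $\partial D$ be the positively oriented boundary of $D=\{|\lambda|>R,\ -\tfrac{2\pi}3<\arg\lambda<-\tfrac{\pi}3\}$, and let \[ S=\{\alpha^2(z-iy):z\ge R,\ 0\le y\le\varepsilon\}\cup\{\alpha(-z-iy):z\ge R,\ 0\le y\le\varepsilon\}\cup\{Re^{i\mu}:-\tfrac{2\pi}3\le\mu\le-\tfrac\pi3\}. \] Let $\Gamma$ be the contour, oriented in the same sense as $\partial D$, that consists of the shifted ray $\{\alpha(-z-i\varepsilon):z\ge R\}$, the segment from $\alpha(-R-i\varepsilon)$ to $-\alpha R$, the arc of $|\lambda|=R$ from $-\alpha R=Re^{-i\pi/3}$ to $\alpha^2R=Re^{-2\pi i/3}$ in $\partial D$, the segment from $\alpha^2R$ to $\alpha^2(R-i\varepsilon)$,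 and the shifted ray $\{\alpha^2(z-i\varepsilon):z\ge R\}$. Suppose that $\theta\in L^1\cap L^\infty(\partial D)$ and $\theta=\phi+\psi$ on $\partial D$, where $\psi\in L^1\cap L^\infty(\partial D)$ satisfies $\psi(\lambda)=O(\lambda^{-4})$ as $\lambda\to\infty$ along $\partial D$, and $\phi$ extends continuously to $S$, is holomorphic in the interior of $S$, and satisfies $\lim_{C\to\infty}\max_{\lambda\in S,\,|\lambda|=C}|\phi(\lambda)|=0$. Then for all $k\in\{0,1,2\}$, $t>0$ and $j\in\{1,2\}$, \[ (-i)^k\lim_{x\to0^+}\partial_x^k\int_{\partial D}e^{i\nu(\alpha^j\lambda)x-i\lambda^3t}\theta(\lambda)\,d\lambda =\int_{\partial D}e^{-i\lambda^3t}\psi(\lambda)\nu(\alpha^j\lambda)^k\,d\lambda+\int_{\Gamma}e^{-i\lambda^3t}\phi(\lambda)\nu(\alpha^j\lambda)^k\,d\lambda, \] and \[ (-i)^k\lim_{x\to0^-}\partial_x^k\int_{\partial D}e^{i\nu(\lambda)x-i\lambda^3t}\theta(\lambda)\,d\lambda =\int_{\partial D}e^{-i\lambda^3t}\psi(\lambda)\nu(\lambda)^k\,d\lambda+\int_{\Gamma}e^{-i\lambda^3t}\phi(\lambda)\nu(\lambda)^k\,d\lambda.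 \] Here the integrals on the left converge absolutely and are $k$ times continuously differentiable in $x$ for $x>0$ (respectively $x<0$), and the integrals on the right converge absolutely. -/

import Mathlib

open Set Filter Topology MeasureTheory Asymptotics

namespace VertexLimit

/-- The primitive cube root of unity `α = e^{2πi/3}`. -/
noncomputable def α : ℂ := Complex.exp (2 * Real.pi * Complex.I / 3)

/-- The root `u`, close to `1` for small `s`, of `u ^ 6 - u ^ 3 + s ^ 3 / 27 = 0` (principal
branches). -/
noncomputable def cardano (s : ℂ) : ℂ :=
  ((1 + (1 - 4 * s ^ 3 / 27) ^ (1 / 2 : ℂ)) / 2) ^ (1 / 3 : ℂ)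

/-- The branch `ν` of the solution of `ν ^ 3 - a ν = z ^ 3` with `ν(z) = z + O(z⁻¹)` as `z → ∞`.
It is holomorphic where `4 |a| ^ 3 < 27 |z| ^ 6`, which is the exterior of the circle that carries
the branch points. See `nu_cubic`, `nu_asymptotic` and `nu_holomorphic`. -/
noncomputable def nu (a : ℝ) (z : ℂ) : ℂ :=
  z * cardano (a / z ^ 2) + a / (3 * z * cardano (a / z ^ 2))

lemma half_re_nonneg (z : ℂ) : 0 ≤ (z ^ (1 / 2 : ℂ)).re := by
  have h : (1 / 2 : ℂ) = ((1 / 2 : ℝ) : ℂ) := by push_cast; rfl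
  by_cases hz : z = 0
  · subst hz
    rw [Complex.zero_cpow (by norm_num)]
    simp
  rw [h, Complex.cpow_ofReal_re]
  refine mul_nonneg (Real.rpow_nonneg (norm_nonneg _) _) (Real.cos_nonneg_of_mem_Icc ?_)
  have h1 := Complex.neg_pi_lt_arg z
  have h2 := Complex.arg_le_pi z
  constructor <;> linarith

lemma cardano_base_re_pos (s : ℂ) : 0 < ((1 + (1 - 4 * s ^ 3 / 27) ^ (1 / 2 : ℂ)) / 2).re := by
  have h := half_re_nonneg (1 - 4 * s ^ 3 / 27)
  have h2 : ((1 + (1 - 4 * s ^ 3 / 27) ^ (1 / 2 : ℂ)) / 2).re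
      = (1 + ((1 - 4 * s ^ 3 / 27) ^ (1 / 2 : ℂ)).re) / 2 := by
    rw [Complex.div_ofNat_re, Complex.add_re, Complex.one_re]
  rw [h2]
  linarith

lemma cardano_ne_zero (s : ℂ) : cardano s ≠ 0 := by
  have h := cardano_base_re_pos s
  intro h0
  rw [cardano, Complex.cpow_eq_zero_iff] at h0
  rw [h0.1] at h
  simp at h

lemma cardano_eq (s : ℂ) : cardano s ^ 6 - cardano s ^ 3 + s ^ 3 / 27 = 0 := by
  set b : ℂ := (1 - 4 * s ^ 3 / 27) ^ (1 / 2 : ℂ) with hb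
  have h3 : cardano s ^ 3 = (1 + b) / 2 := by
    have := Complex.cpow_nat_inv_pow ((1 + b) / 2) (n := 3) (by norm_num)
    rw [cardano, ← hb, one_div]
    exact_mod_cast this
  have h2 : b ^ 2 = 1 - 4 * s ^ 3 / 27 := by
    have := Complex.cpow_nat_inv_pow (1 - 4 * s ^ 3 / 27) (n := 2) (by norm_num)
    rw [hb, one_div]
    exact_mod_cast this
  have h6 : cardano s ^ 6 = ((1 + b) / 2) ^ 2 := by rw [← h3]; ring
  rw [h6, h3]
  linear_combination h2 / 4

lemma nu_cubic (a : ℝ) {z : ℂ} (hz : z ≠ 0) : nu a z ^ 3 - a * nu a z = z ^ 3 := by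
  have hu := cardano_ne_zero (a / z ^ 2)
  have h := cardano_eq (a / z ^ 2)
  rw [nu]
  set u := cardano (a / z ^ 2)
  field_simp at h ⊢
  linear_combination h

lemma cardano_differentiableAt {s : ℂ} (hs : 4 * ‖s‖ ^ 3 < 27) : DifferentiableAt ℂ cardano s := by
  have h1 : (1 - 4 * s ^ 3 / 27) ∈ Complex.slitPlane := by
    have hlt : ‖4 * s ^ 3 / 27‖ < 1 := by
      rw [norm_div, norm_mul, norm_pow]
      norm_num
      linarith
    have := Complex.mem_slitPlane_of_norm_lt_one (z := -(4 * s ^ 3 / 27)) (by rwa [norm_neg])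
    simpa [sub_eq_add_neg] using this
  have h2 : ((1 + (1 - 4 * s ^ 3 / 27) ^ (1 / 2 : ℂ)) / 2) ∈ Complex.slitPlane :=
    Or.inl (cardano_base_re_pos s)
  unfold cardano
  refine DifferentiableAt.cpow ?_ (differentiableAt_const _) h2
  refine ((differentiableAt_const _).add ?_).div_const _
  refine DifferentiableAt.cpow ?_ (differentiableAt_const _) h1
  fun_prop

lemma nu_holomorphic (a : ℝ) :
    DifferentiableOn ℂ (nu a) {z | 4 * |a| ^ 3 < 27 * ‖z‖ ^ 6} := by
  intro z hz
  have hz' : 4 * |a| ^ 3 < 27 * ‖z‖ ^ 6 := hz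
  have hz0 : z ≠ 0 := by
    rintro rfl
    have : 0 ≤ |a| ^ 3 := by positivity
    norm_num at hz'
    linarith
  have hs : 4 * ‖(a : ℂ) / z ^ 2‖ ^ 3 < 27 := by
    have hn : 0 < ‖z‖ := norm_pos_iff.2 hz0
    rw [norm_div, norm_pow, Complex.norm_real, Real.norm_eq_abs, div_pow, ← pow_mul, ← mul_div_assoc,
      div_lt_iff₀ (by positivity)]
    exact hz'
  have hu : DifferentiableAt ℂ (fun w : ℂ => cardano ((a : ℂ) / w ^ 2)) z := by
    refine DifferentiableAt.comp (g := cardano) z (cardano_differentiableAt hs) ?_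
    exact (differentiableAt_const _).div (by fun_prop) (pow_ne_zero 2 hz0)
  have hu0 := cardano_ne_zero ((a : ℂ) / z ^ 2)
  apply DifferentiableAt.differentiableWithinAt
  unfold nu
  refine (differentiableAt_id.mul hu).add ((differentiableAt_const _).div ?_ ?_)
  · exact (differentiableAt_id.const_mul _).mul hu
  · exact mul_ne_zero (mul_ne_zero (by norm_num) hz0) hu0

lemma nu_asymptotic (a : ℝ) :
    (fun z => nu a z - z) =O[Bornology.cobounded ℂ] fun z => z⁻¹ := by
  have hinv : Tendsto (fun z : ℂ => z⁻¹) (Bornology.cobounded ℂ) (𝓝 0) :=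
    tendsto_inv₀_cobounded
  have hs : Tendsto (fun z : ℂ => (a : ℂ) / z ^ 2) (Bornology.cobounded ℂ) (𝓝 0) := by
    have := (hinv.pow 2).const_mul (a : ℂ)
    simpa [div_eq_mul_inv] using this
  have hc0 : cardano 0 = 1 := by
    have : (1 + 1 : ℂ) / 2 = 1 := by norm_num
    simp [cardano, this]
  have hu : Tendsto (fun z : ℂ => cardano ((a : ℂ) / z ^ 2)) (Bornology.cobounded ℂ) (𝓝 1) := by
    have hc := (cardano_differentiableAt (s := 0) (by norm_num)).continuousAt.tendsto
    rw [hc0] at hc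
    exact hc.comp hs
  have hg : Tendsto (fun z : ℂ => cardano ((a : ℂ) / z ^ 2)
      + (a : ℂ) / z ^ 2 / (3 * cardano ((a : ℂ) / z ^ 2))) (Bornology.cobounded ℂ) (𝓝 1) := by
    have := hu.add (hs.div (hu.const_mul 3) (by norm_num))
    simpa using this
  set g : ℂ → ℂ := fun z => cardano ((a : ℂ) / z ^ 2)
      + (a : ℂ) / z ^ 2 / (3 * cardano ((a : ℂ) / z ^ 2)) with hgdef
  have hden : Tendsto (fun z => g z ^ 2 + g z + 1) (Bornology.cobounded ℂ) (𝓝 3) := by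
    have := ((hg.pow 2).add hg).add_const 1
    norm_num at this
    exact this
  have hq : Tendsto (fun z => (a : ℂ) * g z / (g z ^ 2 + g z + 1)) (Bornology.cobounded ℂ)
      (𝓝 ((a : ℂ) * 1 / 3)) := (hg.const_mul _).div hden (by norm_num)
  have hne : ∀ᶠ z in Bornology.cobounded ℂ, z ≠ 0 := Bornology.eventually_ne_cobounded 0
  have hne2 : ∀ᶠ z in Bornology.cobounded ℂ, g z ^ 2 + g z + 1 ≠ 0 :=
    hden.eventually_ne (by norm_num)
  have key : (fun z => nu a z - z) =ᶠ[Bornology.cobounded ℂ]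
      fun z => ((a : ℂ) * g z / (g z ^ 2 + g z + 1)) * z⁻¹ := by
    filter_upwards [hne, hne2] with z hz hz2
    have hng : nu a z = z * g z := by
      have := cardano_ne_zero ((a : ℂ) / z ^ 2)
      simp only [nu, hgdef]
      field_simp
    have hcub := nu_cubic a hz
    rw [hng] at hcub ⊢
    clear hng
    generalize g z = G at hcub hz2 ⊢
    rw [← div_eq_mul_inv, eq_div_iff hz, eq_div_iff hz2]
    have h' : z * (G ^ 3 * z ^ 2 - z ^ 2 - a * G) = 0 := by linear_combination hcub
    have h'' := (mul_eq_zero.1 h').resolve_left hz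
    linear_combination h''
  refine key.trans_isBigO ?_
  have := (hq.isBigO_one ℂ).mul (isBigO_refl (fun z : ℂ => z⁻¹) (Bornology.cobounded ℂ))
  simpa using this

/-- A smooth piece of an oriented contour: a unit speed path, run over `dom` in increasing
direction. -/
structure Piece where
  path : ℝ → ℂ
  dom : Set ℝ

/-- The points of a contour. -/
def trace (c : List Piece) : Set ℂ := {z | ∃ p ∈ c, ∃ s ∈ p.dom, p.path s = z}

/-- `f ∈ L^q` of the contour, for arc length. -/
def MemLpOn (f : ℂ → ℂ) (q : ENNReal) (c : List Piece) : Prop :=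
  ∀ p ∈ c, MemLp (fun s => f (p.path s)) q (volume.restrict p.dom)

/-- Absolute convergence of `∫_c f(z) dz`. -/
def IntegrableAlong (f : ℂ → ℂ) (c : List Piece) : Prop :=
  ∀ p ∈ c, IntegrableOn (fun s => f (p.path s) * deriv p.path s) p.dom

/-- The contour integral `∫_c f(z) dz`. -/
noncomputable def integralAlong (f : ℂ → ℂ) (c : List Piece) : ℂ :=
  (c.map fun p => ∫ s in p.dom, f (p.path s) * deriv p.path s).sum

/-- The arc of `|z| = R` from `R e^{-iπ/3} = -α R` clockwise to `R e^{-2πi/3} = α² R`. -/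
noncomputable def arcPiece (R : ℝ) : Piece where
  path s := R * Complex.exp (-(Real.pi / 3 + s / R : ℝ) * Complex.I)
  dom := Icc 0 (Real.pi * R / 3)

/-- The positively oriented boundary `∂D` of the sector
`D = {|z| > R, -2π/3 < arg z < -π/3}`: from `∞` along the ray of argument `-π/3`, along the arc,
and to `∞` along the ray of argument `-2π/3`. -/
noncomputable def bdryD (R : ℝ) : List Piece :=
  [⟨fun s => α * s, Iic (-R)⟩, arcPiece R, ⟨fun s => α ^ 2 * s, Ici R⟩]

/-- The contour `Γ`: as `∂D`, but with both rays shifted by `ε`, away from `D`, and joined to the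
arc by segments of length `ε`. -/
noncomputable def Gam (R ε : ℝ) : List Piece :=
  [⟨fun s => α * (s - Complex.I * ε), Iic (-R)⟩,
   ⟨fun s => α * (-R + Complex.I * s), Icc (-ε) 0⟩,
   arcPiece R,
   ⟨fun s => α ^ 2 * (R - Complex.I * s), Icc 0 ε⟩,
   ⟨fun s => α ^ 2 * (s - Complex.I * ε), Ici R⟩]

/-- The closed set `S` between `∂D` and `Γ`: two closed semistrips and the common arc. -/
noncomputable def S (R ε : ℝ) : Set ℂ :=
  {w | ∃ z y : ℝ, R ≤ z ∧ y ∈ Icc 0 ε ∧ w = α ^ 2 * (z - Complex.I * y)} ∪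
  {w | ∃ z y : ℝ, R ≤ z ∧ y ∈ Icc 0 ε ∧ w = α * (-z - Complex.I * y)} ∪
  {w | ∃ μ ∈ Icc (-(2 * Real.pi / 3)) (-(Real.pi / 3)), w = R * Complex.exp (μ * Complex.I)}

/-- `E_j(z; x, t) = exp(i ν(α^j z) x - i z³ t)`. -/
noncomputable def E (a : ℝ) (j : ℕ) (x t : ℝ) (z : ℂ) : ℂ :=
  Complex.exp (Complex.I * nu a (α ^ j * z) * x - Complex.I * z ^ 3 * t)

end VertexLimit

/-! On the rays of `∂D` the cube `z ^ 3` is real, so `exp(-i z³ t)` has modulus one there. Each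
`x`-derivative costs a factor `ν ~ z`, which an `L¹` density cannot absorb in general. The two parts
of `θ` are therefore treated on different contours.

The part `ψ` stays on `∂D`: since `ψ = O(z⁻⁴)`, even `z² ψ` is integrable
(`norm_pow_mul_le_of_isBigO`, `integrableAlong_exp_mul_nu_bdryD`). The part `φ` is moved to `Γ`,
where `Im (s - iε)³ = ε³ - 3 s² ε` makes `exp(-i z³ t)` decay like a Gaussian, so any power of `ν`
is integrable against it (`integrableOn_shiftedRay`).

The factor `exp(i ν(α^j z) x)` is controlled on all of `S` by `exp(K |x|)`, for `x` on the
appropriate half line (`IsDecaySide.norm_exp_le`): `ν(w) - w` is bounded, and `Im (α^j z)` is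
bounded on the side that matters. This bound is uniform in `z` and stays finite as `x → 0`. Hence
dominated convergence gives both differentiation under the integral and the limit
(`hasDerivLimit_integral_exp`).

For fixed `x` the shift from `∂D` to `Γ` is Cauchy's theorem in two half strips
(`integralAlong_bdryD_eq_Gam`): both exponentials are bounded on `S` and `φ → 0`, so the far edges
of the truncated rectangles vanish. -/

namespace VertexLimit

/-! ### Differentiation under the integral sign for exponential integrands -/

section ParametricIntegral

variable {μ : Measure ℝ} {g h : ℝ → ℂ} {U : Set ℝ} {K : ℝ}

/-- The base point need not lie in `U`: besides continuity on `U`, this yields the limit at the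
endpoint `0` of a half line. -/
lemma tendsto_integral_exp (hg : AEStronglyMeasurable g μ) (hh : Integrable h μ)
    (hb : ∀ᵐ s ∂μ, ∀ x ∈ U, ‖Complex.exp (Complex.I * g s * (x : ℝ))‖ ≤ Real.exp (K * |x|))
    (x₀ : ℝ) :
    Tendsto (fun x : ℝ => ∫ s, Complex.exp (Complex.I * g s * x) * h s ∂μ) (𝓝[U] x₀)
      (𝓝 (∫ s, Complex.exp (Complex.I * g s * x₀) * h s ∂μ)) := by
  refine tendsto_integral_filter_of_dominated_convergence
    -- A majorant free of `x`, valid where `|x| < |x₀| + 1`; `|K|` appears because `K` may be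
    -- negative.
    (fun s => Real.exp (|K| * (|x₀| + 1)) * ‖h s‖) ?_ ?_ (hh.norm.const_mul _) ?_
  · refine Eventually.of_forall fun x => AEStronglyMeasurable.mul ?_ hh.1
    exact Complex.continuous_exp.comp_aestronglyMeasurable ((hg.const_mul _).mul_const _)
  · have h1 : ∀ᶠ x : ℝ in 𝓝[U] x₀, |x| < |x₀| + 1 :=
      nhdsWithin_le_nhds ((continuous_abs.tendsto x₀).eventually_lt_const (by linarith))
    filter_upwards [h1, self_mem_nhdsWithin] with x hx hxU
    filter_upwards [hb] with s hs
    rw [norm_mul]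
    refine mul_le_mul_of_nonneg_right ((hs x hxU).trans (Real.exp_le_exp.2 ?_)) (norm_nonneg _)
    exact mul_le_mul (le_abs_self K) hx.le (abs_nonneg _) (abs_nonneg _)
  · refine Eventually.of_forall fun s => ?_
    have : Continuous fun x : ℝ => Complex.exp (Complex.I * g s * x) * h s := by fun_prop
    exact (this.tendsto x₀).mono_left nhdsWithin_le_nhds

lemma integrable_exp_mul (hg : AEStronglyMeasurable g μ) (hh : Integrable h μ)
    (hb : ∀ᵐ s ∂μ, ∀ x ∈ U, ‖Complex.exp (Complex.I * g s * (x : ℝ))‖ ≤ Real.exp (K * |x|))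
    {x : ℝ} (hx : x ∈ U) : Integrable (fun s => Complex.exp (Complex.I * g s * x) * h s) μ := by
  refine hh.bdd_mul (c := Real.exp (K * |x|)) ?_ ?_
  · exact Complex.continuous_exp.comp_aestronglyMeasurable ((hg.const_mul _).mul_const _)
  · filter_upwards [hb] with s hs using hs x hx

lemma hasDerivAt_integral_exp (hU : IsOpen U) (hg : AEStronglyMeasurable g μ)
    (hh : Integrable h μ) (hgh : Integrable (fun s => g s * h s) μ)
    (hb : ∀ᵐ s ∂μ, ∀ x ∈ U, ‖Complex.exp (Complex.I * g s * (x : ℝ))‖ ≤ Real.exp (K * |x|))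
    {x₀ : ℝ} (hx₀ : x₀ ∈ U) :
    HasDerivAt (fun x : ℝ => ∫ s, Complex.exp (Complex.I * g s * x) * h s ∂μ)
      (∫ s, Complex.exp (Complex.I * g s * x₀) * (Complex.I * g s * h s) ∂μ) x₀ := by
  have hN : U ∩ {x | |x| < |x₀| + 1} ∈ 𝓝 x₀ :=
    inter_mem (hU.mem_nhds hx₀)
      ((continuous_abs.tendsto x₀).eventually_lt_const (by linarith))
  refine (hasDerivAt_integral_of_dominated_loc_of_deriv_le
    (bound := fun s => Real.exp (|K| * (|x₀| + 1)) * ‖g s * h s‖)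
    (F' := fun (x : ℝ) s => Complex.exp (Complex.I * g s * x) * (Complex.I * g s * h s))
    hN ?_ (integrable_exp_mul hg hh hb hx₀) ?_ ?_ (hgh.norm.const_mul _) ?_).2
  · refine Eventually.of_forall fun x => AEStronglyMeasurable.mul ?_ hh.1
    exact Complex.continuous_exp.comp_aestronglyMeasurable ((hg.const_mul _).mul_const _)
  · refine AEStronglyMeasurable.mul ?_ ((hg.const_mul _).mul hh.1)
    exact Complex.continuous_exp.comp_aestronglyMeasurable ((hg.const_mul _).mul_const _)
  · filter_upwards [hb] with s hs x hx
    rw [mul_assoc Complex.I (g s) (h s), norm_mul, norm_mul Complex.I, Complex.norm_I, one_mul]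
    refine mul_le_mul_of_nonneg_right ((hs x hx.1).trans (Real.exp_le_exp.2 ?_)) (norm_nonneg _)
    exact mul_le_mul (le_abs_self K) (le_of_lt hx.2) (abs_nonneg _) (abs_nonneg _)
  · refine Eventually.of_forall fun s x _ => ?_
    have h1 : HasDerivAt (fun x : ℝ => Complex.I * g s * (x : ℂ)) (Complex.I * g s) x := by
      simpa using (Complex.ofRealCLM.hasDerivAt (x := x)).const_mul (Complex.I * g s)
    have := (h1.cexp).mul_const (h s)
    rwa [mul_assoc] at this

/-- One derivative only replaces the density `h` by `i g h`, so the induction on `k` must run over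
all densities at once. The moments up to order `k` are what it consumes. -/
lemma iteratedDeriv_integral_exp (hU : IsOpen U) (hg : AEStronglyMeasurable g μ)
    (hb : ∀ᵐ s ∂μ, ∀ x ∈ U, ‖Complex.exp (Complex.I * g s * (x : ℝ))‖ ≤ Real.exp (K * |x|))
    (k : ℕ) :
    ∀ h : ℝ → ℂ, (∀ m ≤ k, Integrable (fun s => g s ^ m * h s) μ) →
    ContDiffOn ℝ k (fun x : ℝ => ∫ s, Complex.exp (Complex.I * g s * x) * h s ∂μ) U ∧
    ∀ x ∈ U, iteratedDeriv k (fun x : ℝ => ∫ s, Complex.exp (Complex.I * g s * x) * h s ∂μ) x =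
      ∫ s, Complex.exp (Complex.I * g s * x) * ((Complex.I * g s) ^ k * h s) ∂μ := by
  induction k with
  | zero =>
    intro h hh
    have h0 : Integrable h μ := by simpa using hh 0 le_rfl
    refine ⟨?_, by simp⟩
    simp only [Nat.cast_zero, contDiffOn_zero]
    exact fun x _ => tendsto_integral_exp hg h0 hb x
  | succ k ih =>
    intro h hh
    have h0 : Integrable h μ := by simpa using hh 0 (Nat.zero_le _)
    have h1 : Integrable (fun s => g s * h s) μ := by simpa using hh 1 (by omega)
    have hd : ∀ x ∈ U, HasDerivAt _ _ x := fun x hx => hasDerivAt_integral_exp hU hg h0 h1 hb hx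
    obtain ⟨c1, c2⟩ := ih (fun s => Complex.I * g s * h s) (fun m hm => by
      have := (hh (m + 1) (by omega)).const_mul Complex.I
      refine this.congr (Eventually.of_forall fun s => ?_)
      simp only
      ring)
    refine ⟨?_, fun x hx => ?_⟩
    · push_cast
      rw [contDiffOn_succ_iff_deriv_of_isOpen hU]
      refine ⟨fun x hx => (hd x hx).differentiableAt.differentiableWithinAt, by simp, ?_⟩
      exact c1.congr fun x hx => (hd x hx).deriv
    · rw [iteratedDeriv_succ']
      have he : deriv (fun x : ℝ => ∫ s, Complex.exp (Complex.I * g s * x) * h s ∂μ) =ᶠ[𝓝 x]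
          fun x : ℝ => ∫ s, Complex.exp (Complex.I * g s * x) * (Complex.I * g s * h s) ∂μ := by
        filter_upwards [hU.mem_nhds hx] with y hy using (hd y hy).deriv
      rw [he.iteratedDeriv_eq, c2 x hx]
      congr 1 with s
      ring

end ParametricIntegral

/-- `F` is `C^k` on `U` and `(-i)^k F^(k)` tends to `L` at `0` along `U`. -/
def HasDerivLimit (k : ℕ) (U : Set ℝ) (F : ℝ → ℂ) (L : ℂ) : Prop :=
  ContDiffOn ℝ k F U ∧
    Tendsto (fun x : ℝ => (-Complex.I) ^ k * iteratedDeriv k F x) (𝓝[U] 0) (𝓝 L)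

section HasDerivLimit

variable {k : ℕ} {U : Set ℝ} {F G : ℝ → ℂ} {L M : ℂ}

lemma HasDerivLimit.add (hU : IsOpen U) (hF : HasDerivLimit k U F L)
    (hG : HasDerivLimit k U G M) : HasDerivLimit k U (fun x => F x + G x) (L + M) := by
  refine ⟨hF.1.add hG.1, (hF.2.add hG.2).congr' ?_⟩
  filter_upwards [self_mem_nhdsWithin] with x hx
  rw [iteratedDeriv_fun_add (hF.1.contDiffAt (hU.mem_nhds hx))
    (hG.1.contDiffAt (hU.mem_nhds hx)), mul_add]

lemma HasDerivLimit.congr (hU : IsOpen U) (hF : HasDerivLimit k U F L)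
    (h : ∀ x ∈ U, G x = F x) : HasDerivLimit k U G L := by
  refine ⟨hF.1.congr h, hF.2.congr' ?_⟩
  filter_upwards [self_mem_nhdsWithin] with x hx
  have : G =ᶠ[𝓝 x] F := by
    filter_upwards [hU.mem_nhds hx] with y hy using h y hy
  rw [this.iteratedDeriv_eq]

lemma HasDerivLimit.zero : HasDerivLimit k U (fun _ => 0) 0 := by
  refine ⟨contDiffOn_const, ?_⟩
  simp only [iteratedDeriv_fun_const_zero, mul_zero]
  exact tendsto_const_nhds

lemma HasDerivLimit.list_sum {ι : Type*} (hU : IsOpen U) (l : List ι) (f : ι → ℝ → ℂ) (c : ι → ℂ)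
    (h : ∀ p ∈ l, HasDerivLimit k U (f p) (c p)) :
    HasDerivLimit k U (fun x => (l.map fun p => f p x).sum) (l.map c).sum := by
  induction l with
  | nil => simpa using HasDerivLimit.zero
  | cons p l ih =>
    simp only [List.map_cons, List.sum_cons]
    exact (h p (by simp)).add hU (ih fun q hq => h q (by simp [hq]))

end HasDerivLimit

lemma hasDerivLimit_integral_exp {μ : Measure ℝ} {g h : ℝ → ℂ} {U : Set ℝ} {K : ℝ}
    (hU : IsOpen U) (hg : AEStronglyMeasurable g μ)
    (hb : ∀ᵐ s ∂μ, ∀ x ∈ U, ‖Complex.exp (Complex.I * g s * (x : ℝ))‖ ≤ Real.exp (K * |x|))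
    (k : ℕ) (hh : ∀ m ≤ k, Integrable (fun s => g s ^ m * h s) μ) :
    HasDerivLimit k U (fun x : ℝ => ∫ s, Complex.exp (Complex.I * g s * x) * h s ∂μ)
      (∫ s, g s ^ k * h s ∂μ) := by
  obtain ⟨h1, h2⟩ := iteratedDeriv_integral_exp hU hg hb k h hh
  refine ⟨h1, ?_⟩
  have := tendsto_integral_exp hg (hh k le_rfl) hb 0
  simp only [Complex.ofReal_zero, mul_zero, Complex.exp_zero, one_mul] at this
  refine this.congr' ?_
  filter_upwards [self_mem_nhdsWithin] with x hx
  rw [h2 x hx, ← integral_const_mul]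
  congr 1 with s
  have : (-Complex.I) ^ k * Complex.I ^ k = 1 := by
    rw [← mul_pow]; simp
  rw [mul_pow]
  linear_combination (-(Complex.exp (Complex.I * g s * x) * (g s ^ k * h s))) * this

/-- Cauchy's theorem for a half strip. -/
lemma integral_halfStrip {f : ℂ → ℂ} {R b c : ℝ}
    (hc : ContinuousOn f (Ici R ×ℂ uIcc b c))
    (hd : DifferentiableOn ℂ f (Ioi R ×ℂ Ioo (min b c) (max b c)))
    (h0 : ∀ η > 0, ∃ M : ℝ, ∀ s ≥ M, ∀ y ∈ uIcc b c, ‖f (s + y * Complex.I)‖ ≤ η)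
    (hb : IntegrableOn (fun s : ℝ => f (s + b * Complex.I)) (Ioi R))
    (hc' : IntegrableOn (fun s : ℝ => f (s + c * Complex.I)) (Ioi R)) :
    (∫ s in Ioi R, f (s + b * Complex.I)) =
      Complex.I * (∫ y in b..c, f (R + y * Complex.I)) + ∫ s in Ioi R, f (s + c * Complex.I) := by
  -- Cauchy on the rectangle cut off at `C`; the edge at `C` tends to zero by `h0`. No order of `b`
  -- and `c` is assumed, so that strips below and above the real axis are both covered.
  have hrect : ∀ C ≥ R, (∫ s in R..C, f (s + b * Complex.I)) =
      (∫ s in R..C, f (s + c * Complex.I)) - Complex.I * (∫ y in b..c, f (C + y * Complex.I)) +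
        Complex.I * (∫ y in b..c, f (R + y * Complex.I)) := by
    intro C hC
    have := Complex.integral_boundary_rect_eq_zero_of_continuousOn_of_differentiableOn f
      (R + b * Complex.I) (C + c * Complex.I)
      (hc.mono (by
        simp only [Complex.add_re, Complex.ofReal_re, Complex.mul_re, Complex.I_re, mul_zero,
          Complex.ofReal_im, Complex.I_im, sub_zero, add_zero, Complex.add_im,
          Complex.mul_im, mul_one, zero_add]
        intro z hz
        rw [Complex.mem_reProdIm] at hz ⊢
        refine ⟨?_, hz.2⟩
        rw [uIcc_of_le hC] at hz
        exact hz.1.1))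
      (hd.mono (by
        simp only [Complex.add_re, Complex.ofReal_re, Complex.mul_re, Complex.I_re, mul_zero,
          Complex.ofReal_im, Complex.I_im, sub_zero, add_zero, Complex.add_im,
          Complex.mul_im, mul_one, zero_add]
        intro z hz
        rw [Complex.mem_reProdIm] at hz ⊢
        refine ⟨?_, hz.2⟩
        rw [min_eq_left hC] at hz
        exact hz.1.1))
    simp only [Complex.add_re, Complex.ofReal_re, Complex.mul_re, Complex.I_re, mul_zero,
      Complex.ofReal_im, Complex.I_im, sub_zero, add_zero, Complex.add_im,
      Complex.mul_im, mul_one, zero_add, smul_eq_mul] at this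
    linear_combination this
  have t1 := intervalIntegral_tendsto_integral_Ioi R hb tendsto_id
  have t2 := intervalIntegral_tendsto_integral_Ioi R hc' tendsto_id
  have t3 : Tendsto (fun C : ℝ => ∫ y in b..c, f (C + y * Complex.I)) atTop (𝓝 0) := by
    rw [Metric.tendsto_atTop]
    intro η hη
    obtain ⟨M, hM⟩ := h0 (η / (2 * (|c - b| + 1))) (by positivity)
    refine ⟨M, fun C hC => ?_⟩
    rw [dist_zero_right]
    have := intervalIntegral.norm_integral_le_of_norm_le_const (a := b) (b := c)
      (f := fun y : ℝ => f (C + y * Complex.I)) (fun y hy => hM C hC y (uIoc_subset_uIcc hy))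
    refine this.trans_lt ?_
    rw [div_mul_eq_mul_div, div_lt_iff₀ (by positivity)]
    nlinarith [abs_nonneg (c - b)]
  have t4 := ((t2.sub (t3.const_mul Complex.I)).add_const
    (Complex.I * (∫ y in b..c, f (R + y * Complex.I))))
  have := tendsto_nhds_unique t1 (t4.congr' (by
    filter_upwards [eventually_ge_atTop R] with C hC
    exact (hrect C hC).symm))
  rw [this]
  ring

/-! ### The cube root of unity and the size of `ν` -/

lemma alpha_eq : α = ⟨-(1 / 2), √3 / 2⟩ := by
  have h : (2 * Real.pi * Complex.I / 3 : ℂ) = ((Real.pi - Real.pi / 3 : ℝ) : ℂ) * Complex.I := by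
    push_cast; ring
  rw [α, h]
  apply Complex.ext
  · rw [Complex.exp_ofReal_mul_I_re, Real.cos_pi_sub, Real.cos_pi_div_three]
  · rw [Complex.exp_ofReal_mul_I_im, Real.sin_pi_sub, Real.sin_pi_div_three]

lemma alpha_sq_eq : α ^ 2 = ⟨-(1 / 2), -(√3 / 2)⟩ := by
  have h : √3 * √3 = 3 := Real.mul_self_sqrt (by norm_num)
  rw [alpha_eq, pow_two]
  apply Complex.ext
  · rw [Complex.mul_re]
    linarith
  · rw [Complex.mul_im]
    ring

lemma alpha_cubed : α ^ 3 = 1 := by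
  have h : √3 * √3 = 3 := Real.mul_self_sqrt (by norm_num)
  rw [pow_succ, alpha_sq_eq, alpha_eq]
  apply Complex.ext
  · rw [Complex.mul_re, Complex.one_re]
    linarith
  · rw [Complex.mul_im, Complex.one_im]
    ring

lemma alpha_pow_four : α ^ 4 = α := by
  rw [pow_succ, alpha_cubed, one_mul]

lemma norm_alpha : ‖α‖ = 1 := by
  have h : (2 * Real.pi * Complex.I / 3 : ℂ) = ((2 * Real.pi / 3 : ℝ) : ℂ) * Complex.I := by
    push_cast; ring
  rw [α, h, Complex.norm_exp_ofReal_mul_I]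

lemma norm_alpha_pow (n : ℕ) : ‖α ^ n‖ = 1 := by rw [norm_pow, norm_alpha, one_pow]

lemma nu_differentiableAt {a R : ℝ} (hR : 0 < R) (haR : 4 * |a| ^ 3 < 27 * R ^ 6) {w : ℂ}
    (hw : R ≤ ‖w‖) : DifferentiableAt ℂ (nu a) w := by
  have ho : IsOpen {z : ℂ | 4 * |a| ^ 3 < 27 * ‖z‖ ^ 6} :=
    isOpen_lt continuous_const (by fun_prop)
  refine (nu_holomorphic a).differentiableAt (ho.mem_nhds ?_)
  have : R ^ 6 ≤ ‖w‖ ^ 6 := pow_le_pow_left₀ hR.le hw 6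
  simp only [mem_ofPred_eq]
  linarith

/-- The asymptotics give the bound outside a large disc; what remains is a compact annulus on which
`ν` is continuous. -/
lemma norm_nu_sub_le {a R : ℝ} (hR : 0 < R) (haR : 4 * |a| ^ 3 < 27 * R ^ 6) :
    ∃ K, 0 ≤ K ∧ ∀ w : ℂ, R ≤ ‖w‖ → ‖nu a w - w‖ ≤ K := by
  have h1 : (fun z => nu a z - z) =O[Bornology.cobounded ℂ] fun _ => (1 : ℂ) :=
    (nu_asymptotic a).trans (tendsto_inv₀_cobounded.isBigO_one ℂ)
  obtain ⟨c, hc⟩ := h1.bound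
  obtain ⟨M, -, hM⟩ := (Metric.hasBasis_cobounded_compl_closedBall (0 : ℂ)).eventually_iff.1 hc
  have hK : IsCompact (Metric.closedBall (0 : ℂ) M ∩ {w | R ≤ ‖w‖}) :=
    (isCompact_closedBall _ _).inter_right (isClosed_le continuous_const continuous_norm)
  obtain ⟨c', hc'⟩ := hK.exists_bound_of_continuousOn (f := fun z => nu a z - z) (fun w hw =>
    ((nu_differentiableAt hR haR hw.2).continuousAt.sub continuousAt_id).continuousWithinAt)
  refine ⟨max 0 (max c c'), le_max_left _ _, fun w hw => ?_⟩
  by_cases h : w ∈ Metric.closedBall (0 : ℂ) M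
  · exact (hc' w ⟨h, hw⟩).trans ((le_max_right _ _).trans (le_max_right _ _))
  · have := hM h
    simp only [norm_one, mul_one] at this
    exact this.trans ((le_max_left _ _).trans (le_max_right _ _))

lemma norm_nu_le {a R : ℝ} (hR : 0 < R) (haR : 4 * |a| ^ 3 < 27 * R ^ 6) :
    ∃ K, 0 ≤ K ∧ ∀ w : ℂ, R ≤ ‖w‖ → ‖nu a w‖ ≤ K * ‖w‖ := by
  obtain ⟨K, hK0, hK⟩ := norm_nu_sub_le hR haR
  refine ⟨1 + K / R, by positivity, fun w hw => ?_⟩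
  have h1 : ‖nu a w‖ ≤ ‖nu a w - w‖ + ‖w‖ := by simpa using norm_add_le (nu a w - w) w
  have h2 : K ≤ K / R * ‖w‖ := by
    rw [div_mul_eq_mul_div, le_div_iff₀ hR]
    exact mul_le_mul_of_nonneg_left hw hK0
  linarith [hK w hw]

/-! ### Geometry of `S` -/

/-- Since `α³ = 1`, multiplication by `α`, respectively `-α²`, undoes the rotation by `α²`,
respectively `-α`, and lays each semistrip along the positive real axis. Closedness and interior
points can then be read off from products of intervals. -/
lemma S_eq (R ε : ℝ) : S R ε =
    ((fun w : ℂ => α * w) ⁻¹' (Ici R ×ℂ Icc (-ε) 0) ∪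
      (fun w : ℂ => -(α ^ 2 * w)) ⁻¹' (Ici R ×ℂ Icc 0 ε)) ∪
    (fun μ : ℝ => R * Complex.exp (μ * Complex.I)) ''
      Icc (-(2 * Real.pi / 3)) (-(Real.pi / 3)) := by
  have h3 := alpha_cubed
  unfold S
  congr 1
  · congr 1
    · ext w
      simp only [mem_ofPred_eq, mem_preimage, Complex.mem_reProdIm, mem_Ici, mem_Icc]
      constructor
      · rintro ⟨z, y, hz, hy, rfl⟩
        have : α * (α ^ 2 * (z - Complex.I * y)) = z - Complex.I * y := by
          linear_combination (z - Complex.I * y) * h3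
        rw [this]
        simpa using ⟨hz, hy.2, hy.1⟩
      · rintro ⟨h1, h2, h4⟩
        refine ⟨(α * w).re, -(α * w).im, h1, ⟨by linarith, by linarith⟩, ?_⟩
        have := Complex.re_add_im (α * w)
        push_cast
        linear_combination (-w) * h3 - α ^ 2 * this
    · ext w
      simp only [mem_ofPred_eq, mem_preimage, Complex.mem_reProdIm, mem_Ici, mem_Icc]
      constructor
      · rintro ⟨z, y, hz, hy, rfl⟩
        have : -(α ^ 2 * (α * (-z - Complex.I * y))) = z + Complex.I * y := by
          linear_combination (z + Complex.I * y) * h3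
        rw [this]
        simpa using ⟨hz, hy.1, hy.2⟩
      · rintro ⟨h1, h2, h4⟩
        refine ⟨(-(α ^ 2 * w)).re, (-(α ^ 2 * w)).im, h1, ⟨by linarith, by linarith⟩, ?_⟩
        have := Complex.re_add_im (-(α ^ 2 * w))
        linear_combination (-w) * h3 + α * this
  · ext w
    simp [eq_comm]

lemma isClosed_S (R ε : ℝ) : IsClosed (S R ε) := by
  rw [S_eq]
  refine (IsClosed.union ?_ ?_).union ?_
  · exact (isClosed_Ici.reProdIm isClosed_Icc).preimage (by fun_prop)
  · exact (isClosed_Ici.reProdIm isClosed_Icc).preimage (by fun_prop)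
  · exact (isCompact_Icc.image (by fun_prop)).isClosed

lemma mem_interior_S_right {R ε : ℝ} {w : ℂ} (hw : w ∈ Ioi R ×ℂ Ioo (-ε) 0) :
    α ^ 2 * w ∈ interior (S R ε) := by
  have ho : IsOpen ((fun w : ℂ => α * w) ⁻¹' (Ioi R ×ℂ Ioo (-ε) 0)) :=
    (isOpen_Ioi.reProdIm isOpen_Ioo).preimage (by fun_prop)
  refine interior_maximal ?_ ho ?_
  · rw [S_eq]
    intro z hz
    have h1 : R < (α * z).re := hz.1
    have h2 : -ε < (α * z).im := hz.2.1
    have h3 : (α * z).im < 0 := hz.2.2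
    exact Or.inl (Or.inl ⟨h1.le, h2.le, h3.le⟩)
  · have : α * (α ^ 2 * w) = w := by linear_combination w * alpha_cubed
    rw [mem_preimage, this]
    exact hw

lemma mem_interior_S_left {R ε : ℝ} {w : ℂ} (hw : w ∈ Ioi R ×ℂ Ioo 0 ε) :
    -(α * w) ∈ interior (S R ε) := by
  have ho : IsOpen ((fun w : ℂ => -(α ^ 2 * w)) ⁻¹' (Ioi R ×ℂ Ioo 0 ε)) :=
    (isOpen_Ioi.reProdIm isOpen_Ioo).preimage (by fun_prop)
  refine interior_maximal ?_ ho ?_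
  · rw [S_eq]
    intro z hz
    have h1 : R < (-(α ^ 2 * z)).re := hz.1
    have h2 : 0 < (-(α ^ 2 * z)).im := hz.2.1
    have h3 : (-(α ^ 2 * z)).im < ε := hz.2.2
    exact Or.inl (Or.inr ⟨h1.le, h2.le, h3.le⟩)
  · have : -(α ^ 2 * -(α * w)) = w := by linear_combination w * alpha_cubed
    rw [mem_preimage, this]
    exact hw

lemma mem_S_right {R ε : ℝ} {w : ℂ} (hw : w ∈ Ici R ×ℂ Icc (-ε) 0) : α ^ 2 * w ∈ S R ε := by
  have : α * (α ^ 2 * w) = w := by linear_combination w * alpha_cubed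
  rw [S_eq]
  exact Or.inl (Or.inl (by rwa [mem_preimage, this]))

lemma mem_S_left {R ε : ℝ} {w : ℂ} (hw : w ∈ Ici R ×ℂ Icc 0 ε) : -(α * w) ∈ S R ε := by
  have : -(α ^ 2 * -(α * w)) = w := by linear_combination w * alpha_cubed
  rw [S_eq]
  exact Or.inl (Or.inr (by rwa [mem_preimage, this]))

lemma norm_arc {R : ℝ} (hR : 0 < R) (μ : ℝ) : ‖(R * Complex.exp (μ * Complex.I) : ℂ)‖ = R := by
  rw [norm_mul, Complex.norm_exp_ofReal_mul_I, mul_one, Complex.norm_real, Real.norm_of_nonneg hR.le]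

lemma le_norm_of_mem_S {R ε : ℝ} (hR : 0 < R) {z : ℂ} (hz : z ∈ S R ε) : R ≤ ‖z‖ := by
  rw [S_eq] at hz
  rcases hz with (hz | hz) | ⟨μ, -, rfl⟩
  · have h1 : R ≤ (α * z).re := hz.1
    have := (Complex.re_le_norm (α * z))
    rw [norm_mul, norm_alpha, one_mul] at this
    linarith
  · have h1 : R ≤ (-(α ^ 2 * z)).re := hz.1
    have := (Complex.re_le_norm (-(α ^ 2 * z)))
    rw [norm_neg, norm_mul, norm_alpha_pow, one_mul] at this
    linarith
  · exact (norm_arc hR μ).ge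

/-! ### Bounds for the two exponentials on `S` -/

lemma im_cube (s y : ℝ) : (((s : ℂ) - Complex.I * y) ^ 3).im = y ^ 3 - 3 * s ^ 2 * y := by
  have : ((s : ℂ) - Complex.I * y) ^ 3
      = ((s ^ 3 - 3 * s * y ^ 2 : ℝ) : ℂ) + ((y ^ 3 - 3 * s ^ 2 * y : ℝ) : ℂ) * Complex.I := by
    push_cast
    linear_combination (3 * s * y ^ 2 - y ^ 3 * Complex.I : ℂ) * Complex.I_sq
  rw [this, Complex.add_im, Complex.ofReal_im, Complex.mul_I_im, Complex.ofReal_re, zero_add]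

lemma norm_exp_cube (z : ℂ) (t : ℝ) :
    ‖Complex.exp (-Complex.I * z ^ 3 * t)‖ = Real.exp ((z ^ 3).im * t) := by
  rw [Complex.norm_exp]
  congr 1
  simp [Complex.mul_re]

lemma alpha_mul_cube (w : ℂ) : (α * w) ^ 3 = w ^ 3 := by
  rw [mul_pow, alpha_cubed, one_mul]

lemma alpha_sq_mul_cube (w : ℂ) : (α ^ 2 * w) ^ 3 = w ^ 3 := by
  linear_combination w ^ 3 * (α ^ 3 + 1) * alpha_cubed

/-- The rotations disappear on cubing, so on the strips the exponent is `(y³ - 3 s² y) t` with `0 ≤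
y ≤ ε`; on the arc `|z³| = R³`. -/
lemma norm_exp_cube_le {R ε t : ℝ} (hR : 0 < R) (ht : 0 < t) {z : ℂ} (hz : z ∈ S R ε) :
    ‖Complex.exp (-Complex.I * z ^ 3 * t)‖ ≤ Real.exp ((R ^ 3 + |ε| ^ 3) * t) := by
  rw [norm_exp_cube]
  refine Real.exp_le_exp.2 (mul_le_mul_of_nonneg_right ?_ ht.le)
  have hy' : ∀ s y : ℝ, 0 ≤ y → y ≤ ε → y ^ 3 - 3 * s ^ 2 * y ≤ R ^ 3 + |ε| ^ 3 := by
    intro s y h1 h2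
    have : y ^ 3 ≤ |ε| ^ 3 := pow_le_pow_left₀ h1 (h2.trans (le_abs_self _)) 3
    have : 0 ≤ 3 * s ^ 2 * y := by positivity
    have : 0 < R ^ 3 := by positivity
    linarith
  rcases hz with (⟨s, y, hs, hy, rfl⟩ | ⟨s, y, hs, hy, rfl⟩) | ⟨μ, -, rfl⟩
  · rw [alpha_sq_mul_cube, im_cube]
    exact hy' s y hy.1 hy.2
  · have := im_cube (-s) y
    push_cast at this
    rw [alpha_mul_cube, this]
    exact hy' (-s) y hy.1 hy.2
  · refine (Complex.im_le_norm _).trans ?_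
    rw [norm_pow, norm_arc hR]
    have : 0 ≤ |ε| ^ 3 := by positivity
    linarith

/-- The half line of times on which the exponentials of index `j` stay bounded. -/
def IsDecaySide (j : ℕ) (U : Set ℝ) : Prop :=
  (j = 0 ∧ U = Iio 0) ∨ ((j = 1 ∨ j = 2) ∧ U = Ioi 0)

lemma IsDecaySide.isOpen {j : ℕ} {U : Set ℝ} (h : IsDecaySide j U) : IsOpen U := by
  rcases h with ⟨-, rfl⟩ | ⟨-, rfl⟩
  · exact isOpen_Iio
  · exact isOpen_Ioi

lemma alpha_mul_im (s y : ℝ) :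
    (α * (s - Complex.I * y)).im = √3 / 2 * s + y / 2 := by
  simp [alpha_eq, Complex.mul_im]
  ring

lemma alpha_sq_mul_im (s y : ℝ) :
    (α ^ 2 * (s - Complex.I * y)).im = -(√3 / 2 * s) + y / 2 := by
  simp [alpha_sq_eq, Complex.mul_im]
  ring

/-- For `j = 1, 2` the factor `α^j` turns one strip into a horizontal strip with imaginary part `-y
≥ -ε`, and the other into the upper half plane. For `j = 0` both strips have imaginary part `-(√3/2)
s + y/2 ≤ ε/2`, which matches `x < 0`. The arc only contributes `R`. -/
lemma IsDecaySide.le_mul_im {j : ℕ} {U : Set ℝ} (h : IsDecaySide j U) {R ε : ℝ} (hR : 0 < R)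
    (hε : 0 < ε) {z : ℂ} (hz : z ∈ S R ε) {x : ℝ} (hx : x ∈ U) :
    -((R + ε) * |x|) ≤ x * (α ^ j * z).im := by
  rcases hz with (⟨s, y, hs, ⟨hy0, hy1⟩, rfl⟩ | ⟨s, y, hs, ⟨hy0, hy1⟩, rfl⟩) | ⟨μ, -, rfl⟩
  · have hm : 0 ≤ √3 / 2 * s := by
      have : 0 ≤ s := hR.le.trans hs
      positivity
    have e1 : α ^ 1 * (α ^ 2 * ((s : ℂ) - Complex.I * y)) = s - Complex.I * y := by
      linear_combination ((s : ℂ) - Complex.I * y) * alpha_cubed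
    have e2 : α ^ 2 * (α ^ 2 * ((s : ℂ) - Complex.I * y)) = α * (s - Complex.I * y) := by
      linear_combination ((s : ℂ) - Complex.I * y) * alpha_pow_four
    rcases h with ⟨rfl, rfl⟩ | ⟨rfl | rfl, rfl⟩
    · have hx : x < 0 := hx
      rw [pow_zero, one_mul, alpha_sq_mul_im, abs_of_neg hx]
      nlinarith [mul_nonneg hm (neg_pos.2 hx).le, mul_nonneg hy0 (neg_pos.2 hx).le,
        mul_nonneg (sub_nonneg.2 hy1) (neg_pos.2 hx).le, mul_pos hR (neg_pos.2 hx)]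
    · have hx : 0 < x := hx
      rw [e1, abs_of_pos hx]
      have : ((s : ℂ) - Complex.I * y).im = -y := by simp
      rw [this]
      nlinarith [mul_nonneg (sub_nonneg.2 hy1) hx.le, mul_pos hR hx]
    · have hx : 0 < x := hx
      rw [e2, alpha_mul_im, abs_of_pos hx]
      nlinarith [mul_nonneg hm hx.le, mul_nonneg hy0 hx.le, mul_pos hR hx, mul_pos hε hx]
  · have hm : 0 ≤ √3 / 2 * s := by
      have : 0 ≤ s := hR.le.trans hs
      positivity
    have e1 : α ^ 1 * (α * (-(s : ℂ) - Complex.I * y)) = α ^ 2 * ((-s : ℝ) - Complex.I * y) := by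
      push_cast; ring
    have e2 : α ^ 2 * (α * (-(s : ℂ) - Complex.I * y)) = -s - Complex.I * y := by
      linear_combination (-(s : ℂ) - Complex.I * y) * alpha_cubed
    rcases h with ⟨rfl, rfl⟩ | ⟨rfl | rfl, rfl⟩
    · have hx : x < 0 := hx
      have := alpha_mul_im (-s) y
      push_cast at this
      rw [pow_zero, one_mul, this, abs_of_neg hx]
      nlinarith [mul_nonneg hm (neg_pos.2 hx).le, mul_nonneg hy0 (neg_pos.2 hx).le,
        mul_nonneg (sub_nonneg.2 hy1) (neg_pos.2 hx).le, mul_pos hR (neg_pos.2 hx)]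
    · have hx : 0 < x := hx
      rw [e1, alpha_sq_mul_im, abs_of_pos hx]
      nlinarith [mul_nonneg hm hx.le, mul_nonneg hy0 hx.le, mul_pos hR hx, mul_pos hε hx]
    · have hx : 0 < x := hx
      rw [e2, abs_of_pos hx]
      have : (-(s : ℂ) - Complex.I * y).im = -y := by simp
      rw [this]
      nlinarith [mul_nonneg (sub_nonneg.2 hy1) hx.le, mul_pos hR hx]
  · set w : ℂ := R * Complex.exp (μ * Complex.I) with hw
    have h1 : |(α ^ j * w).im| ≤ R := by
      refine (Complex.abs_im_le_norm _).trans ?_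
      rw [norm_mul, norm_alpha_pow, one_mul, hw, norm_arc hR]
    have h2 : |x * (α ^ j * w).im| ≤ R * |x| := by
      rw [abs_mul, mul_comm]
      exact mul_le_mul_of_nonneg_right h1 (abs_nonneg _)
    have := neg_abs_le (x * (α ^ j * w).im)
    nlinarith [mul_nonneg hε.le (abs_nonneg x)]

/-- Replacing `ν(w)` by `w` changes the exponent by at most a constant times `|x|`, so the bound for
`w = α^j z` carries over. -/
lemma IsDecaySide.norm_exp_le {j : ℕ} {U : Set ℝ} (h : IsDecaySide j U) {a R ε : ℝ} (hR : 0 < R)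
    (haR : 4 * |a| ^ 3 < 27 * R ^ 6) (hε : 0 < ε) :
    ∃ K, ∀ z ∈ S R ε, ∀ x ∈ U,
      ‖Complex.exp (Complex.I * nu a (α ^ j * z) * (x : ℝ))‖ ≤ Real.exp (K * |x|) := by
  obtain ⟨K, -, hK⟩ := norm_nu_sub_le hR haR
  refine ⟨K + (R + ε), fun z hz x hx => ?_⟩
  rw [Complex.norm_exp, Real.exp_le_exp]
  have h1 := h.le_mul_im hR hε hz hx
  have h2 : (Complex.I * nu a (α ^ j * z) * (x : ℝ)).re = -(x * (nu a (α ^ j * z)).im) := by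
    simp [Complex.mul_re, mul_comm]
  have h3 : ‖nu a (α ^ j * z) - α ^ j * z‖ ≤ K := by
    refine hK _ ?_
    rw [norm_mul, norm_alpha_pow, one_mul]
    exact le_norm_of_mem_S hR hz
  have h4 : |x * (nu a (α ^ j * z) - α ^ j * z).im| ≤ K * |x| := by
    rw [abs_mul, mul_comm]
    exact mul_le_mul_of_nonneg_right ((Complex.abs_im_le_norm _).trans h3) (abs_nonneg _)
  have h5 := neg_abs_le (x * (nu a (α ^ j * z) - α ^ j * z).im)
  rw [Complex.sub_im, mul_sub] at h4 h5
  rw [h2]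
  linarith

/-! ### Uniform decay and boundedness of `φ` -/

section DecayOnS

variable {R ε : ℝ} {φ : ℂ → ℂ}

lemma norm_le_of_tendsto_sSup (hφc : ContinuousOn φ (S R ε))
    (hφ : Tendsto (fun C : ℝ => sSup ((fun z => ‖φ z‖) '' {z ∈ S R ε | ‖z‖ = C})) atTop (𝓝 0))
    {η : ℝ} (hη : 0 < η) : ∃ M : ℝ, ∀ z ∈ S R ε, M ≤ ‖z‖ → ‖φ z‖ ≤ η := by
  obtain ⟨M, hM⟩ := eventually_atTop.1 (hφ.eventually_lt_const hη)
  refine ⟨M, fun z hz hzM => le_trans ?_ (hM ‖z‖ hzM).le⟩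
  -- A real `sSup` dominates its set only if the set is bounded above; here `S` meets each circle in
  -- a compact set on which `φ` is continuous.
  refine le_csSup ?_ ⟨z, ⟨hz, rfl⟩, rfl⟩
  have hK : IsCompact {w ∈ S R ε | ‖w‖ = ‖z‖} := by
    have : {w ∈ S R ε | ‖w‖ = ‖z‖} = Metric.sphere 0 ‖z‖ ∩ S R ε := by
      ext w; simp [and_comm]
    rw [this]
    exact (isCompact_sphere _ _).inter_right (isClosed_S R ε)
  exact (hK.image_of_continuousOn (hφc.mono fun w hw => hw.1).norm).bddAbove

lemma exists_norm_le_of_tendsto_sSup (hφc : ContinuousOn φ (S R ε))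
    (hφ : Tendsto (fun C : ℝ => sSup ((fun z => ‖φ z‖) '' {z ∈ S R ε | ‖z‖ = C})) atTop (𝓝 0)) :
    ∃ B, 0 ≤ B ∧ ∀ z ∈ S R ε, ‖φ z‖ ≤ B := by
  obtain ⟨M, hM⟩ := norm_le_of_tendsto_sSup hφc hφ one_pos
  have hK : IsCompact (Metric.closedBall 0 M ∩ S R ε) :=
    (isCompact_closedBall _ _).inter_right (isClosed_S R ε)
  obtain ⟨c, hc⟩ := hK.exists_bound_of_continuousOn (hφc.mono inter_subset_right)
  refine ⟨max 1 c, zero_le_one.trans (le_max_left _ _), fun z hz => ?_⟩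
  rcases le_total M ‖z‖ with h | h
  · exact (hM z hz h).trans (le_max_left _ _)
  · exact (hc z ⟨by simpa using h, hz⟩).trans (le_max_right _ _)

end DecayOnS

/-! ### The pieces of `∂D` and `Γ` as paths in `S` -/

/-- `p` is a piece of a `C¹` path of speed at most one which lies in `T`. -/
structure IsPieceIn (p : Piece) (T : Set ℂ) : Prop where
  measurableSet_dom : MeasurableSet p.dom
  continuous_path : Continuous p.path
  continuous_deriv : Continuous (deriv p.path)
  norm_deriv_le : ∀ s, ‖deriv p.path s‖ ≤ 1
  path_mem : ∀ s ∈ p.dom, p.path s ∈ T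

lemma deriv_mul_sub (β c : ℂ) : deriv (fun s : ℝ => β * ((s : ℂ) - c)) = fun _ => β := by
  funext s
  simpa using (((Complex.ofRealCLM.hasDerivAt (x := s)).sub_const c).const_mul β).deriv

lemma deriv_mul_ofReal (β : ℂ) : deriv (fun s : ℝ => β * (s : ℂ)) = fun _ => β := by
  simpa using deriv_mul_sub β 0

lemma deriv_mul_add_I_mul (β c : ℂ) :
    deriv (fun s : ℝ => β * (c + Complex.I * (s : ℂ))) = fun _ => β * Complex.I := by
  funext s
  simpa using ((((Complex.ofRealCLM.hasDerivAt (x := s)).const_mul Complex.I).const_add c).const_mul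
    β).deriv

lemma deriv_mul_sub_I_mul (β c : ℂ) :
    deriv (fun s : ℝ => β * (c - Complex.I * (s : ℂ))) = fun _ => -(β * Complex.I) := by
  funext s
  simpa using ((((Complex.ofRealCLM.hasDerivAt (x := s)).const_mul Complex.I).const_sub c).const_mul
    β).deriv

lemma deriv_arcPiece {R : ℝ} (hR : 0 < R) : deriv (arcPiece R).path =
    fun s : ℝ => -Complex.I * Complex.exp (-(Real.pi / 3 + s / R : ℝ) * Complex.I) := by
  funext s
  have hR' : (R : ℂ) ≠ 0 := by exact_mod_cast hR.ne'
  have h1 : HasDerivAt (fun s : ℝ => (-(Real.pi / 3 + s / R : ℝ) * Complex.I : ℂ))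
      (-(1 / R) * Complex.I) s := by
    have := ((((Complex.ofRealCLM.hasDerivAt (x := s)).div_const (R : ℂ)).const_add
      ((Real.pi : ℂ) / 3)).neg).mul_const Complex.I
    simpa using this
  have h2 := (h1.cexp.const_mul (R : ℂ)).deriv
  have h3 : (arcPiece R).path =
      fun s : ℝ => (R * Complex.exp (-(Real.pi / 3 + s / R : ℝ) * Complex.I) : ℂ) := rfl
  rw [h3, h2]
  field_simp

lemma isPieceIn_arcPiece {R : ℝ} (hR : 0 < R) (ε : ℝ) : IsPieceIn (arcPiece R) (S R ε) where
  measurableSet_dom := measurableSet_Icc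
  continuous_path := by unfold arcPiece; fun_prop
  continuous_deriv := by rw [deriv_arcPiece hR]; fun_prop
  norm_deriv_le s := by
    simp only [deriv_arcPiece hR]
    rw [← Complex.ofReal_neg, norm_mul, Complex.norm_exp_ofReal_mul_I]
    simp
  path_mem s hs := by
    refine Or.inr ⟨-(Real.pi / 3 + s / R), ⟨?_, ?_⟩, by simp [arcPiece]⟩
    · have : s / R ≤ Real.pi / 3 := by
        rw [div_le_iff₀ hR]
        linarith [hs.2]
      linarith
    · have : 0 ≤ s / R := div_nonneg hs.1 hR.le
      linarith

lemma norm_arcPiece_path {R : ℝ} (hR : 0 < R) (s : ℝ) : ‖(arcPiece R).path s‖ = R := by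
  have := norm_arc hR (-(Real.pi / 3 + s / R))
  rw [Complex.ofReal_neg] at this
  exact this

section Rays

variable {R ε : ℝ}

lemma isPieceIn_right {y : ℝ} (hy : y ∈ Icc 0 ε) :
    IsPieceIn ⟨fun s => α ^ 2 * (s - Complex.I * y), Ici R⟩ (S R ε) where
  measurableSet_dom := measurableSet_Ici
  continuous_path := by fun_prop
  continuous_deriv := by rw [deriv_mul_sub]; fun_prop
  norm_deriv_le s := by rw [deriv_mul_sub, norm_alpha_pow]
  path_mem s hs := Or.inl (Or.inl ⟨s, y, hs, hy, rfl⟩)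

lemma isPieceIn_left {y : ℝ} (hy : y ∈ Icc 0 ε) :
    IsPieceIn ⟨fun s => α * (s - Complex.I * y), Iic (-R)⟩ (S R ε) where
  measurableSet_dom := measurableSet_Iic
  continuous_path := by fun_prop
  continuous_deriv := by rw [deriv_mul_sub]; fun_prop
  norm_deriv_le s := by rw [deriv_mul_sub, norm_alpha]
  path_mem s hs := Or.inl (Or.inr ⟨-s, y, by linarith [mem_Iic.1 hs], hy, by push_cast; ring⟩)

lemma isPieceIn_bdryD (hR : 0 < R) (hε : 0 ≤ ε) : ∀ p ∈ bdryD R, IsPieceIn p (S R ε) := by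
  intro p hp
  simp only [bdryD, List.mem_cons, List.not_mem_nil, or_false] at hp
  rcases hp with rfl | rfl | rfl
  · simpa using isPieceIn_left (R := R) (ε := ε) (y := 0) ⟨le_rfl, hε⟩
  · exact isPieceIn_arcPiece hR ε
  · simpa using isPieceIn_right (R := R) (ε := ε) (y := 0) ⟨le_rfl, hε⟩

lemma isPieceIn_Gam (hR : 0 < R) (hε : 0 ≤ ε) : ∀ p ∈ Gam R ε, IsPieceIn p (S R ε) := by
  intro p hp
  simp only [Gam, List.mem_cons, List.not_mem_nil, or_false] at hp
  rcases hp with rfl | rfl | rfl | rfl | rfl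
  · exact isPieceIn_left ⟨hε, le_rfl⟩
  · refine ⟨measurableSet_Icc, by fun_prop, ?_, fun s => ?_, fun s hs => ?_⟩
    · rw [deriv_mul_add_I_mul]; fun_prop
    · rw [deriv_mul_add_I_mul, norm_mul, norm_alpha]; simp
    · exact Or.inl (Or.inr ⟨R, -s, le_rfl, ⟨by linarith [hs.2], by linarith [hs.1]⟩,
        by push_cast; ring⟩)
  · exact isPieceIn_arcPiece hR ε
  · refine ⟨measurableSet_Icc, by fun_prop, ?_, fun s => ?_, fun s hs => ?_⟩
    · rw [deriv_mul_sub_I_mul]; fun_prop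
    · rw [deriv_mul_sub_I_mul, norm_neg, norm_mul, norm_alpha_pow]; simp
    · exact Or.inl (Or.inl ⟨R, s, le_rfl, hs, rfl⟩)
  · exact isPieceIn_right ⟨hε, le_rfl⟩

end Rays

/-! ### Integrability and limits along the contours -/

section Contours

variable {a R ε t : ℝ} {j k : ℕ} {U : Set ℝ} {f : ℂ → ℂ} {p : Piece} {c : List Piece}

lemma E_eq (a : ℝ) (j : ℕ) (x t : ℝ) (z : ℂ) : E a j x t z =
    Complex.exp (Complex.I * nu a (α ^ j * z) * x) * Complex.exp (-Complex.I * z ^ 3 * t) := by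
  rw [E, ← Complex.exp_add]
  ring_nf

lemma le_norm_alpha_pow_mul (hR : 0 < R) (j : ℕ) {z : ℂ} (hz : z ∈ S R ε) :
    R ≤ ‖α ^ j * z‖ := by
  rw [norm_mul, norm_alpha_pow, one_mul]
  exact le_norm_of_mem_S hR hz

lemma differentiableAt_nu_alpha (hR : 0 < R) (haR : 4 * |a| ^ 3 < 27 * R ^ 6) (j : ℕ) {z : ℂ}
    (hz : z ∈ S R ε) : DifferentiableAt ℂ (fun z => nu a (α ^ j * z)) z :=
  (nu_differentiableAt hR haR (le_norm_alpha_pow_mul hR j hz)).comp z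
    (differentiableAt_id.const_mul _)

lemma IsPieceIn.continuousOn_nu (hp : IsPieceIn p (S R ε)) (hR : 0 < R)
    (haR : 4 * |a| ^ 3 < 27 * R ^ 6) (j : ℕ) :
    ContinuousOn (fun s => nu a (α ^ j * p.path s)) p.dom := fun s hs =>
  ((differentiableAt_nu_alpha hR haR j (hp.path_mem s hs)).continuousAt.comp
    (f := p.path) hp.continuous_path.continuousAt).continuousWithinAt

lemma IsPieceIn.ae (hp : IsPieceIn p (S R ε)) :
    ∀ᵐ s ∂volume.restrict p.dom, p.path s ∈ S R ε :=
  (ae_restrict_iff' hp.measurableSet_dom).2 (Eventually.of_forall hp.path_mem)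

lemma integrableAlong_E_mul (hside : IsDecaySide j U) (hR : 0 < R)
    (haR : 4 * |a| ^ 3 < 27 * R ^ 6) (hε : 0 < ε) (hc : ∀ p ∈ c, IsPieceIn p (S R ε))
    (hf : IntegrableAlong (fun z => Complex.exp (-Complex.I * z ^ 3 * t) * f z) c)
    {x : ℝ} (hx : x ∈ U) : IntegrableAlong (fun z => E a j x t z * f z) c := by
  obtain ⟨K, hK⟩ := hside.norm_exp_le hR haR hε
  intro p hp
  have hpc := hc p hp
  have := integrable_exp_mul (U := U) (K := K) (x := x)
    ((hpc.continuousOn_nu hR haR j).aestronglyMeasurable hpc.measurableSet_dom) (hf p hp)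
    (by filter_upwards [hpc.ae] with s hs using hK _ hs) hx
  refine this.congr (Eventually.of_forall fun s => ?_)
  simp only [E_eq]
  ring

lemma hasDerivLimit_integralAlong (hside : IsDecaySide j U) (hR : 0 < R)
    (haR : 4 * |a| ^ 3 < 27 * R ^ 6) (hε : 0 < ε) (hc : ∀ p ∈ c, IsPieceIn p (S R ε))
    (hf : ∀ m ≤ k, IntegrableAlong (fun z =>
      Complex.exp (-Complex.I * z ^ 3 * t) * f z * nu a (α ^ j * z) ^ m) c) :
    HasDerivLimit k U (fun x => integralAlong (fun z => E a j x t z * f z) c)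
      (integralAlong (fun z =>
        Complex.exp (-Complex.I * z ^ 3 * t) * f z * nu a (α ^ j * z) ^ k) c) := by
  obtain ⟨K, hK⟩ := hside.norm_exp_le hR haR hε
  unfold integralAlong
  refine HasDerivLimit.list_sum hside.isOpen c _ _ fun p hp => ?_
  have hpc := hc p hp
  have := hasDerivLimit_integral_exp (K := K) hside.isOpen
    ((hpc.continuousOn_nu hR haR j).aestronglyMeasurable hpc.measurableSet_dom)
    (by filter_upwards [hpc.ae] with s hs using hK _ hs) k
    (h := fun s => Complex.exp (-Complex.I * p.path s ^ 3 * t) * f (p.path s) * deriv p.path s)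
    (fun m hm => (hf m hm p hp).congr (Eventually.of_forall fun s => by simp only; ring))
  convert this using 1
  · funext x
    congr 1 with s
    simp only [E_eq]
    ring
  · congr 1 with s
    ring

lemma integrableAlong_exp_mul (hR : 0 < R) (ht : 0 < t) (hc : ∀ p ∈ c, IsPieceIn p (S R ε))
    (hf : MemLpOn f 1 c) :
    IntegrableAlong (fun z => Complex.exp (-Complex.I * z ^ 3 * t) * f z) c := by
  intro p hp
  have hpc := hc p hp
  have hfp : Integrable (fun s => f (p.path s)) (volume.restrict p.dom) :=
    memLp_one_iff_integrable.1 (hf p hp)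
  have h1 := hfp.bdd_mul (f := fun s => Complex.exp (-Complex.I * p.path s ^ 3 * t))
    (c := Real.exp ((R ^ 3 + |ε| ^ 3) * t))
    (by have := hpc.continuous_path; exact Continuous.aestronglyMeasurable (by fun_prop))
    (by filter_upwards [hpc.ae] with s hs using norm_exp_cube_le hR ht hs)
  exact h1.mul_bdd (c := 1) hpc.continuous_deriv.aestronglyMeasurable
    (Eventually.of_forall hpc.norm_deriv_le)

lemma integrableOn_inv_one_add_sq_bdryD (hR : 0 < R) :
    ∀ p ∈ bdryD R, IntegrableOn (fun s => (1 + ‖p.path s‖ ^ 2)⁻¹) p.dom := by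
  intro p hp
  simp only [bdryD, List.mem_cons, List.not_mem_nil, or_false] at hp
  rcases hp with rfl | rfl | rfl
  · simpa [norm_alpha] using integrable_inv_one_add_sq.integrableOn
  · simp only [norm_arcPiece_path hR]
    exact (continuousOn_const).integrableOn_compact isCompact_Icc
  · simpa [norm_alpha] using integrable_inv_one_add_sq.integrableOn

/-- Near the origin the weight is bounded and `|ψ|` itself is the majorant; far out, `|z|² |z|⁻⁴ =
|z|⁻²` is. -/
lemma norm_pow_mul_le_of_isBigO {T : Set ℂ} {ψ : ℂ → ℂ}
    (hψ : ψ =O[Bornology.cobounded ℂ ⊓ 𝓟 T] fun z => z ^ (-4 : ℤ)) {m : ℕ} (hm : m ≤ 2) :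
    ∃ A B, ∀ z ∈ T, ‖z‖ ^ m * ‖ψ z‖ ≤ A * ‖ψ z‖ + B * (1 + ‖z‖ ^ 2)⁻¹ := by
  obtain ⟨C, hC0, hC⟩ := hψ.exists_nonneg
  have h1 := hC.bound
  rw [eventually_inf_principal] at h1
  obtain ⟨M, -, hM⟩ := (Metric.hasBasis_cobounded_compl_closedBall (0 : ℂ)).eventually_iff.1 h1
  -- Beyond radius `1` one has `|z|^m ≤ |z|²` and `|z|⁻² ≤ 2 / (1 + |z|²)`, whence the factor `2`.
  refine ⟨max M 1 ^ m, 2 * C, fun z hz => ?_⟩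
  rcases le_or_gt ‖z‖ (max M 1) with h | h
  · have h2 : ‖z‖ ^ m ≤ max M 1 ^ m := pow_le_pow_left₀ (norm_nonneg _) h m
    have h3 := mul_le_mul_of_nonneg_right h2 (norm_nonneg (ψ z))
    have : 0 ≤ 2 * C * (1 + ‖z‖ ^ 2)⁻¹ := by positivity
    linarith
  · have hz1 : 1 < ‖z‖ := (le_max_right _ _).trans_lt h
    have hzM : M < ‖z‖ := (le_max_left _ _).trans_lt h
    have h2 : ‖ψ z‖ ≤ C * ‖z ^ (-4 : ℤ)‖ := hM (by simpa using hzM) hz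
    have h4 : ‖z ^ (-4 : ℤ)‖ = (‖z‖ ^ 4)⁻¹ := by
      rw [norm_zpow, zpow_neg]
      norm_cast
    rw [h4] at h2
    have h5 : ‖z‖ ^ m ≤ ‖z‖ ^ 2 := pow_le_pow_right₀ hz1.le hm
    have h6 : ‖z‖ ^ m * ‖ψ z‖ ≤ ‖z‖ ^ 2 * (C * (‖z‖ ^ 4)⁻¹) :=
      mul_le_mul h5 h2 (norm_nonneg _) (by positivity)
    have h7 : ‖z‖ ^ 2 * (C * (‖z‖ ^ 4)⁻¹) ≤ 2 * C * (1 + ‖z‖ ^ 2)⁻¹ := by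
      have hne : ‖z‖ ≠ 0 := by linarith
      have e1 : ‖z‖ ^ 2 * (C * (‖z‖ ^ 4)⁻¹) = C * (‖z‖ ^ 2)⁻¹ := by field_simp
      have e2 : (‖z‖ ^ 2)⁻¹ ≤ 2 * (1 + ‖z‖ ^ 2)⁻¹ := by
        rw [← div_eq_mul_inv, inv_eq_one_div, div_le_div_iff₀ (by positivity) (by positivity)]
        nlinarith
      rw [e1, mul_comm 2 C, mul_assoc]
      exact mul_le_mul_of_nonneg_left e2 hC0
    have h8 : 0 ≤ max M 1 ^ m * ‖ψ z‖ := by positivity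
    linarith

lemma integrableAlong_exp_mul_nu_bdryD {ψ : ℂ → ℂ} (hR : 0 < R) (haR : 4 * |a| ^ 3 < 27 * R ^ 6)
    (ht : 0 < t) (hψ1 : MemLpOn ψ 1 (bdryD R))
    (hψ : ψ =O[Bornology.cobounded ℂ ⊓ 𝓟 (trace (bdryD R))] fun z => z ^ (-4 : ℤ))
    (j : ℕ) {m : ℕ} (hm : m ≤ 2) :
    IntegrableAlong (fun z => Complex.exp (-Complex.I * z ^ 3 * t) * ψ z * nu a (α ^ j * z) ^ m)
      (bdryD R) := by
  obtain ⟨K, hK0, hK⟩ := norm_nu_le hR haR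
  obtain ⟨A, B, hAB⟩ := norm_pow_mul_le_of_isBigO hψ hm
  intro p hp
  -- The strips may be taken of width `0`: `∂D` already lies in `S R 0`.
  have hpc := isPieceIn_bdryD hR le_rfl p hp
  have hψp : Integrable (fun s => ψ (p.path s)) (volume.restrict p.dom) :=
    memLp_one_iff_integrable.1 (hψ1 p hp)
  have hbase := integrableAlong_exp_mul hR ht (isPieceIn_bdryD hR le_rfl) hψ1 p hp
  have hg : Integrable (fun s => Real.exp ((R ^ 3 + |(0 : ℝ)| ^ 3) * t) * K ^ m *
      (A * ‖ψ (p.path s)‖ + B * (1 + ‖p.path s‖ ^ 2)⁻¹)) (volume.restrict p.dom) :=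
    ((hψp.norm.const_mul A).add
      ((integrableOn_inv_one_add_sq_bdryD hR p hp).const_mul B)).const_mul _
  refine Integrable.mono' hg ?_ ?_
  · have h1 := hbase.1.mul
      (((hpc.continuousOn_nu hR haR j).pow m).aestronglyMeasurable hpc.measurableSet_dom)
    refine h1.congr (Eventually.of_forall fun s => ?_)
    simp only [Pi.mul_apply, Pi.pow_apply]
    ring
  · refine (ae_restrict_iff' hpc.measurableSet_dom).2 (Eventually.of_forall fun s hs => ?_)
    have hS := hpc.path_mem s hs
    have h1 := norm_exp_cube_le hR ht hS
    have h2 := hK _ (le_norm_alpha_pow_mul hR j hS)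
    rw [norm_mul (α ^ j), norm_alpha_pow, one_mul] at h2
    have h3 := hAB (p.path s) ⟨p, hp, s, hs, rfl⟩
    have h4 := hpc.norm_deriv_le s
    have h5 : ‖nu a (α ^ j * p.path s)‖ ^ m ≤ K ^ m * ‖p.path s‖ ^ m := by
      rw [← mul_pow]
      exact pow_le_pow_left₀ (norm_nonneg _) h2 m
    rw [norm_mul, norm_mul, norm_mul, norm_pow (nu a _)]
    calc _ ≤ Real.exp ((R ^ 3 + |(0 : ℝ)| ^ 3) * t) * ‖ψ (p.path s)‖ *
          (K ^ m * ‖p.path s‖ ^ m) * 1 := by gcongr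
      _ = Real.exp ((R ^ 3 + |(0 : ℝ)| ^ 3) * t) * K ^ m *
          (‖p.path s‖ ^ m * ‖ψ (p.path s)‖) := by ring
      _ ≤ _ := by gcongr

lemma IsPieceIn.continuousOn_integrand {φ : ℂ → ℂ} (hp : IsPieceIn p (S R ε)) (hR : 0 < R)
    (haR : 4 * |a| ^ 3 < 27 * R ^ 6) (hφc : ContinuousOn φ (S R ε)) (t : ℝ) (j m : ℕ) :
    ContinuousOn (fun s => Complex.exp (-Complex.I * p.path s ^ 3 * t) * φ (p.path s) *
      nu a (α ^ j * p.path s) ^ m * deriv p.path s) p.dom := by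
  have h1 := hp.continuous_path
  refine ((ContinuousOn.mul ?_ ?_).mul ((hp.continuousOn_nu hR haR j).pow m)).mul
    hp.continuous_deriv.continuousOn
  · exact Continuous.continuousOn (by fun_prop)
  · exact hφc.comp h1.continuousOn hp.path_mem

/-- The modulus of `exp(-i z³ t)` is `exp(ε³ t) exp(-3 ε t s²)`, which beats the polynomial growth
of `ν^m`. Taking `β = α` and `β = α²` gives the two shifted rays. -/
lemma integrableOn_shiftedRay {φ : ℂ → ℂ} {β : ℂ} {d : Set ℝ} {B : ℝ} (hβ : ‖β‖ = 1)
    (hβ3 : β ^ 3 = 1) (hR : 0 < R) (hε : 0 < ε) (ht : 0 < t) (haR : 4 * |a| ^ 3 < 27 * R ^ 6)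
    (hp : IsPieceIn ⟨fun s => β * (s - Complex.I * ε), d⟩ (S R ε)) (hd : ∀ s ∈ d, R ≤ |s|)
    (hφc : ContinuousOn φ (S R ε)) (hB0 : 0 ≤ B) (hB : ∀ z ∈ S R ε, ‖φ z‖ ≤ B) (j m : ℕ) :
    IntegrableOn (fun s : ℝ =>
      Complex.exp (-Complex.I * (β * ((s : ℂ) - Complex.I * ε)) ^ 3 * t) *
      φ (β * (s - Complex.I * ε)) * nu a (α ^ j * (β * (s - Complex.I * ε))) ^ m *
      deriv (fun s : ℝ => β * ((s : ℂ) - Complex.I * ε)) s) d := by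
  obtain ⟨K, hK0, hK⟩ := norm_nu_le hR haR
  have hgauss : Integrable (fun s : ℝ => s ^ m * Real.exp (-(3 * ε * t) * s ^ 2)) := by
    have := integrable_rpow_mul_exp_neg_mul_sq (b := 3 * ε * t) (by positivity) (s := (m : ℝ))
      (by have : (0 : ℝ) ≤ m := by positivity
          linarith)
    simpa using this
  have hmaj : IntegrableOn (fun s : ℝ => Real.exp (ε ^ 3 * t) * B * (K * (1 + ε / R)) ^ m *
      ‖s ^ m * Real.exp (-(3 * ε * t) * s ^ 2)‖) d := (hgauss.norm.const_mul _).integrableOn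
  refine Integrable.mono' hmaj ((hp.continuousOn_integrand hR haR hφc t j m).aestronglyMeasurable
    hp.measurableSet_dom) ?_
  refine (ae_restrict_iff' hp.measurableSet_dom).2 (Eventually.of_forall fun s hs => ?_)
  have hS : β * ((s : ℂ) - Complex.I * ε) ∈ S R ε := hp.path_mem s hs
  have h1 : ‖Complex.exp (-Complex.I * (β * ((s : ℂ) - Complex.I * ε)) ^ 3 * t)‖ =
      Real.exp (ε ^ 3 * t) * Real.exp (-(3 * ε * t) * s ^ 2) := by
    rw [norm_exp_cube, mul_pow, hβ3, one_mul, im_cube, ← Real.exp_add]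
    ring_nf
  have h2 := hK _ (le_norm_alpha_pow_mul hR j hS)
  rw [norm_mul (α ^ j), norm_alpha_pow, one_mul, norm_mul β, hβ, one_mul] at h2
  have h3 : ‖(s : ℂ) - Complex.I * ε‖ ≤ (1 + ε / R) * |s| := by
    have e1 := norm_sub_le (s : ℂ) (Complex.I * ε)
    rw [norm_mul, Complex.norm_I, one_mul, Complex.norm_real, Complex.norm_real,
      Real.norm_of_nonneg hε.le, Real.norm_eq_abs] at e1
    -- The shift is absorbed into `|s|`, since `|s| ≥ R` on the ray.
    have e2 : ε ≤ ε / R * |s| := by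
      rw [div_mul_eq_mul_div, le_div_iff₀ hR]
      exact mul_le_mul_of_nonneg_left (hd s hs) hε.le
    linarith
  have h5 : ‖nu a (α ^ j * (β * ((s : ℂ) - Complex.I * ε)))‖ ^ m ≤
      (K * (1 + ε / R)) ^ m * |s| ^ m := by
    rw [← mul_pow, mul_assoc]
    exact pow_le_pow_left₀ (norm_nonneg _)
      (h2.trans (mul_le_mul_of_nonneg_left h3 hK0)) m
  have h6 : ‖deriv (fun s : ℝ => β * ((s : ℂ) - Complex.I * ε)) s‖ ≤ 1 := hp.norm_deriv_le s
  have h7 : ‖s ^ m * Real.exp (-(3 * ε * t) * s ^ 2)‖ =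
      |s| ^ m * Real.exp (-(3 * ε * t) * s ^ 2) := by
    rw [norm_mul, norm_pow, Real.norm_eq_abs, Real.norm_of_nonneg (Real.exp_nonneg _)]
  rw [norm_mul, norm_mul, norm_mul, norm_pow (nu a _), h1, h7]
  calc _ ≤ Real.exp (ε ^ 3 * t) * Real.exp (-(3 * ε * t) * s ^ 2) * B *
        ((K * (1 + ε / R)) ^ m * |s| ^ m) * 1 := by
        gcongr
        exact hB _ hS
    _ = _ := by ring

lemma integrableAlong_exp_mul_nu_Gam {φ : ℂ → ℂ} (hR : 0 < R) (haR : 4 * |a| ^ 3 < 27 * R ^ 6)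
    (hε : 0 < ε) (ht : 0 < t) (hφc : ContinuousOn φ (S R ε))
    (hφ : Tendsto (fun C : ℝ => sSup ((fun z => ‖φ z‖) '' {z ∈ S R ε | ‖z‖ = C})) atTop (𝓝 0))
    (j m : ℕ) :
    IntegrableAlong (fun z => Complex.exp (-Complex.I * z ^ 3 * t) * φ z * nu a (α ^ j * z) ^ m)
      (Gam R ε) := by
  obtain ⟨B, hB0, hB⟩ := exists_norm_le_of_tendsto_sSup hφc hφ
  intro p hp
  have hpc := isPieceIn_Gam hR hε.le p hp
  have hcont := hpc.continuousOn_integrand hR haR hφc t j m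
  simp only [Gam, List.mem_cons, List.not_mem_nil, or_false] at hp
  rcases hp with rfl | rfl | rfl | rfl | rfl
  · exact integrableOn_shiftedRay norm_alpha alpha_cubed hR hε ht haR hpc
      (fun s hs => by rw [abs_of_nonpos] <;> linarith [mem_Iic.1 hs]) hφc hB0 hB j m
  · exact hcont.integrableOn_compact isCompact_Icc
  · exact hcont.integrableOn_compact isCompact_Icc
  · exact hcont.integrableOn_compact isCompact_Icc
  · exact integrableOn_shiftedRay (norm_alpha_pow 2)
      (by rw [← pow_mul, mul_comm, pow_mul, alpha_cubed, one_pow]) hR hε ht haR hpc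
      (fun s hs => by rw [abs_of_nonneg] <;> linarith [mem_Ici.1 hs]) hφc hB0 hB j m

end Contours

/-! ### Moving the contour from `∂D` to `Γ` -/

section Deformation

variable {R ε : ℝ} {G : ℂ → ℂ}

lemma integralAlong_bdryD (R : ℝ) (G : ℂ → ℂ) : integralAlong G (bdryD R) =
    (∫ s in Iic (-R), G (α * s)) * α +
      ((∫ s in (arcPiece R).dom, G ((arcPiece R).path s) * deriv (arcPiece R).path s) +
        (∫ s in Ici R, G (α ^ 2 * s)) * α ^ 2) := by
  simp only [integralAlong, bdryD, List.map_cons, List.map_nil, List.sum_cons, List.sum_nil,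
    add_zero, deriv_mul_ofReal, integral_mul_const]

lemma integralAlong_Gam (R ε : ℝ) (G : ℂ → ℂ) : integralAlong G (Gam R ε) =
    (∫ s in Iic (-R), G (α * (s - Complex.I * ε))) * α +
      ((∫ s in Icc (-ε) 0, G (α * (-R + Complex.I * s))) * (α * Complex.I) +
      ((∫ s in (arcPiece R).dom, G ((arcPiece R).path s) * deriv (arcPiece R).path s) +
      ((∫ s in Icc 0 ε, G (α ^ 2 * (R - Complex.I * s))) * -(α ^ 2 * Complex.I) +
        (∫ s in Ici R, G (α ^ 2 * (s - Complex.I * ε))) * α ^ 2))) := by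
  simp only [integralAlong, Gam, List.map_cons, List.map_nil, List.sum_cons, List.sum_nil,
    add_zero, deriv_mul_sub, deriv_mul_add_I_mul, deriv_mul_sub_I_mul, integral_mul_const]

lemma integrableOn_of_mul_const {f : ℝ → ℂ} {β : ℂ} {d : Set ℝ} (hβ : β ≠ 0)
    (h : IntegrableOn (fun s => f s * β) d) : IntegrableOn f d := by
  refine (h.mul_const β⁻¹).congr (Eventually.of_forall fun s => ?_)
  simp only
  field_simp

lemma alpha_ne_zero : α ≠ 0 := norm_ne_zero_iff.1 (by rw [norm_alpha]; exact one_ne_zero)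

/-- A contour integral over `∂D` may be shifted to `Γ`. -/
lemma integralAlong_bdryD_eq_Gam (hε : 0 < ε)
    (hc : ContinuousOn G (S R ε)) (hd : DifferentiableOn ℂ G (interior (S R ε)))
    (h0 : ∀ η > 0, ∃ M : ℝ, ∀ z ∈ S R ε, M ≤ ‖z‖ → ‖G z‖ ≤ η)
    (hD : IntegrableAlong G (bdryD R)) (hΓ : IntegrableAlong G (Gam R ε)) :
    integralAlong G (bdryD R) = integralAlong G (Gam R ε) := by
  have hα := alpha_ne_zero
  have i1 : IntegrableOn (fun s : ℝ => G (α * s)) (Iic (-R)) := by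
    have := hD ⟨fun s => α * s, Iic (-R)⟩ (by simp [bdryD])
    simp only [deriv_mul_ofReal] at this
    exact integrableOn_of_mul_const hα this
  have i2 : IntegrableOn (fun s : ℝ => G (α ^ 2 * s)) (Ici R) := by
    have := hD ⟨fun s => α ^ 2 * s, Ici R⟩ (by simp [bdryD])
    simp only [deriv_mul_ofReal] at this
    exact integrableOn_of_mul_const (pow_ne_zero 2 hα) this
  have i3 : IntegrableOn (fun s : ℝ => G (α * (s - Complex.I * ε))) (Iic (-R)) := by
    have := hΓ ⟨fun s => α * (s - Complex.I * ε), Iic (-R)⟩ (by simp [Gam])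
    simp only [deriv_mul_sub] at this
    exact integrableOn_of_mul_const hα this
  have i4 : IntegrableOn (fun s : ℝ => G (α ^ 2 * (s - Complex.I * ε))) (Ici R) := by
    have := hΓ ⟨fun s => α ^ 2 * (s - Complex.I * ε), Ici R⟩ (by simp [Gam])
    simp only [deriv_mul_sub] at this
    exact integrableOn_of_mul_const (pow_ne_zero 2 hα) this
  -- In the coordinate `z = α² w` the outgoing ray is the real half line and `Γ` lies below it.
  have right := integral_halfStrip (f := fun w => G (α ^ 2 * w)) (R := R) (b := 0) (c := -ε)
    (by
      rw [uIcc_of_ge (by linarith)]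
      exact hc.comp (by fun_prop) fun w hw => mem_S_right hw)
    (by
      rw [min_eq_right (by linarith), max_eq_left (by linarith)]
      exact hd.comp (by fun_prop) fun w hw => mem_interior_S_right hw)
    (fun η hη => by
      obtain ⟨M, hM⟩ := h0 η hη
      refine ⟨max M R, fun s hs y hy => hM _ (mem_S_right ?_) ?_⟩
      · rw [uIcc_of_ge (by linarith)] at hy
        rw [Complex.mem_reProdIm]
        simpa using ⟨(le_max_right _ _).trans hs, hy⟩
      · rw [norm_mul, norm_alpha_pow, one_mul]
        refine ((le_max_left _ _).trans hs).trans ?_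
        simpa using Complex.re_le_norm ((s : ℂ) + y * Complex.I))
    (by simpa using i2.mono_set Ioi_subset_Ici_self)
    (by
      refine (i4.mono_set Ioi_subset_Ici_self).congr (Eventually.of_forall fun s => ?_)
      simp only [Complex.ofReal_neg]
      ring_nf)
  -- With `z = -α w` the incoming ray also becomes the positive half line, traversed backwards, and
  -- `Γ` now lies above it.
  have left := integral_halfStrip (f := fun w => G (-(α * w))) (R := R) (b := 0) (c := ε)
    (by
      rw [uIcc_of_le hε.le]
      exact hc.comp (by fun_prop) fun w hw => mem_S_left hw)
    (by
      rw [min_eq_left hε.le, max_eq_right hε.le]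
      exact hd.comp (by fun_prop) fun w hw => mem_interior_S_left hw)
    (fun η hη => by
      obtain ⟨M, hM⟩ := h0 η hη
      refine ⟨max M R, fun s hs y hy => hM _ (mem_S_left ?_) ?_⟩
      · rw [uIcc_of_le hε.le] at hy
        rw [Complex.mem_reProdIm]
        simpa using ⟨(le_max_right _ _).trans hs, hy⟩
      · rw [norm_neg, norm_mul, norm_alpha, one_mul]
        refine ((le_max_left _ _).trans hs).trans ?_
        simpa using Complex.re_le_norm ((s : ℂ) + y * Complex.I))
    (by
      have := (i1.mono_set Iio_subset_Iic_self).comp_neg_Ioi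
      simpa using this)
    (by
      have := (i3.mono_set Iio_subset_Iic_self).comp_neg_Ioi
      refine this.congr (Eventually.of_forall fun s => ?_)
      simp only [Complex.ofReal_neg]
      ring_nf)
  have e1 : ∫ s in Iic (-R), G (α * s) = ∫ s in Ioi R, G (-(α * (s + (0 : ℝ) * Complex.I))) := by
    rw [← integral_comp_neg_Ioi R fun s : ℝ => G (α * s)]
    congr 1 with s
    simp
  have e2 : ∫ s in Iic (-R), G (α * (s - Complex.I * ε)) =
      ∫ s in Ioi R, G (-(α * (s + ε * Complex.I))) := by
    rw [← integral_comp_neg_Ioi R fun s : ℝ => G (α * (s - Complex.I * ε))]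
    congr 1 with s
    push_cast
    ring_nf
  have e3 : ∫ s in Icc (-ε) 0, G (α * (-R + Complex.I * s)) =
      ∫ y in (0 : ℝ)..ε, G (-(α * (R + y * Complex.I))) := by
    rw [integral_Icc_eq_integral_Ioc, ← intervalIntegral.integral_of_le (by linarith)]
    have := intervalIntegral.integral_comp_neg (a := 0) (b := ε)
      (fun s : ℝ => G (α * (-R + Complex.I * s)))
    rw [neg_zero] at this
    rw [← this]
    congr 1 with s
    push_cast
    ring_nf
  have e4 : ∫ s in Icc 0 ε, G (α ^ 2 * (R - Complex.I * s)) =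
      -∫ y in (0 : ℝ)..(-ε), G (α ^ 2 * (R + y * Complex.I)) := by
    rw [integral_Icc_eq_integral_Ioc, ← intervalIntegral.integral_of_le hε.le,
      ← intervalIntegral.integral_symm]
    have := intervalIntegral.integral_comp_neg (a := 0) (b := ε)
      (fun y : ℝ => G (α ^ 2 * (R + y * Complex.I)))
    rw [neg_zero] at this
    rw [← this]
    congr 1 with s
    push_cast
    ring_nf
  have e5 : ∫ s in Ici R, G (α ^ 2 * s) =
      ∫ s in Ioi R, G (α ^ 2 * (s + (0 : ℝ) * Complex.I)) := by
    rw [integral_Ici_eq_integral_Ioi]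
    simp
  have e6 : ∫ s in Ici R, G (α ^ 2 * (s - Complex.I * ε)) =
      ∫ s in Ioi R, G (α ^ 2 * (s + (-ε : ℝ) * Complex.I)) := by
    rw [integral_Ici_eq_integral_Ioi]
    congr 1 with s
    push_cast
    ring_nf
  -- The arc is common to both contours, and the finite edges of the half strips are exactly the
  -- joining segments of `Γ`.
  rw [integralAlong_bdryD, integralAlong_Gam, e1, e2, e3, e4, e5, e6, left, right]
  ring

end Deformation

/-! ### Splitting `θ` and assembling the limit -/

lemma integralAlong_add {f g : ℂ → ℂ} {c : List Piece} (hf : IntegrableAlong f c)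
    (hg : IntegrableAlong g c) :
    integralAlong (fun z => f z + g z) c = integralAlong f c + integralAlong g c := by
  unfold integralAlong
  rw [← List.sum_map_add]
  congr 1
  refine List.map_congr_left fun p hp => ?_
  rw [← integral_add (hf p hp) (hg p hp)]
  congr 1 with s
  ring

lemma integralAlong_congr {f g : ℂ → ℂ} {c : List Piece} (hc : ∀ p ∈ c, MeasurableSet p.dom)
    (h : ∀ z ∈ trace c, f z = g z) : integralAlong f c = integralAlong g c := by
  unfold integralAlong
  congr 1
  refine List.map_congr_left fun p hp => ?_
  refine setIntegral_congr_fun (hc p hp) fun s hs => ?_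
  rw [h _ ⟨p, hp, s, hs, rfl⟩]

lemma MemLpOn.sub {f g : ℂ → ℂ} {q : ENNReal} {c : List Piece} (hf : MemLpOn f q c)
    (hg : MemLpOn g q c) : MemLpOn (fun z => f z - g z) q c :=
  fun p hp => (hf p hp).sub (hg p hp)

lemma MemLpOn.congr {f g : ℂ → ℂ} {q : ENNReal} {c : List Piece} (hf : MemLpOn f q c)
    (hc : ∀ p ∈ c, MeasurableSet p.dom) (h : ∀ z ∈ trace c, f z = g z) : MemLpOn g q c :=
  fun p hp => (memLp_congr_ae ((ae_restrict_iff' (hc p hp)).2 (Eventually.of_forall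
    fun s hs => h _ ⟨p, hp, s, hs, rfl⟩))).1 (hf p hp)

lemma differentiableAt_E {a R ε : ℝ} (hR : 0 < R) (haR : 4 * |a| ^ 3 < 27 * R ^ 6) (j : ℕ) (x t : ℝ)
    {z : ℂ} (hz : z ∈ S R ε) : DifferentiableAt ℂ (E a j x t) z := by
  have := differentiableAt_nu_alpha hR haR j hz
  unfold E
  fun_prop

lemma integralAlong_E_mul_bdryD_eq_Gam {a R ε t : ℝ} {φ : ℂ → ℂ} {j : ℕ} {U : Set ℝ}
    (hside : IsDecaySide j U) (hR : 0 < R) (haR : 4 * |a| ^ 3 < 27 * R ^ 6) (hε : 0 < ε)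
    (ht : 0 < t) (hφ1 : MemLpOn φ 1 (bdryD R))
    (hφc : ContinuousOn φ (S R ε)) (hφd : DifferentiableOn ℂ φ (interior (S R ε)))
    (hφ : Tendsto (fun C : ℝ => sSup ((fun z => ‖φ z‖) '' {z ∈ S R ε | ‖z‖ = C})) atTop (𝓝 0))
    {x : ℝ} (hx : x ∈ U) :
    integralAlong (fun z => E a j x t z * φ z) (bdryD R) =
      integralAlong (fun z => E a j x t z * φ z) (Gam R ε) := by
  obtain ⟨K, hK⟩ := hside.norm_exp_le hR haR hε
  refine integralAlong_bdryD_eq_Gam hε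
    (ContinuousOn.mul (fun z hz =>
      (differentiableAt_E hR haR j x t hz).continuousAt.continuousWithinAt) hφc)
    (DifferentiableOn.mul (fun z hz =>
      (differentiableAt_E hR haR j x t (interior_subset hz)).differentiableWithinAt) hφd)
    (fun η hη => ?_)
    (integrableAlong_E_mul hside hR haR hε (isPieceIn_bdryD hR hε.le)
      (integrableAlong_exp_mul hR ht (isPieceIn_bdryD hR hε.le) hφ1) hx)
    (integrableAlong_E_mul hside hR haR hε (isPieceIn_Gam hR hε.le)
      -- Exponent `0` removes the factor `ν`.
      (by simpa using integrableAlong_exp_mul_nu_Gam hR haR hε ht hφc hφ j 0) hx)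
  have hB : 0 < Real.exp (K * |x|) * Real.exp ((R ^ 3 + |ε| ^ 3) * t) := by positivity
  -- With `x` and `t` fixed, `E` is merely bounded on `S`; the decay at infinity comes from `φ`
  -- alone.
  obtain ⟨M, hM⟩ := norm_le_of_tendsto_sSup hφc hφ (div_pos hη hB)
  refine ⟨M, fun z hz hzM => ?_⟩
  rw [norm_mul, E_eq, norm_mul]
  calc _ ≤ Real.exp (K * |x|) * Real.exp ((R ^ 3 + |ε| ^ 3) * t) *
        (η / (Real.exp (K * |x|) * Real.exp ((R ^ 3 + |ε| ^ 3) * t))) := by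
        gcongr
        · exact hK z hz x hx
        · exact norm_exp_cube_le hR ht hz
        · exact hM z hz hzM
    _ = η := by field_simp

lemma hasDerivLimit_integralAlong_E {a R ε t : ℝ} {θ φ ψ : ℂ → ℂ} {j k : ℕ} {U : Set ℝ}
    (hside : IsDecaySide j U) (hR : 0 < R) (haR : 4 * |a| ^ 3 < 27 * R ^ 6) (hε : 0 < ε)
    (hθ1 : MemLpOn θ 1 (bdryD R)) (hψ1 : MemLpOn ψ 1 (bdryD R))
    (hsum : ∀ z ∈ trace (bdryD R), θ z = φ z + ψ z)
    (hψ : ψ =O[Bornology.cobounded ℂ ⊓ 𝓟 (trace (bdryD R))] fun z => z ^ (-4 : ℤ))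
    (hφc : ContinuousOn φ (S R ε)) (hφd : DifferentiableOn ℂ φ (interior (S R ε)))
    (hφ : Tendsto (fun C : ℝ => sSup ((fun z => ‖φ z‖) '' {z ∈ S R ε | ‖z‖ = C})) atTop (𝓝 0))
    (hk : k ≤ 2) (ht : 0 < t) :
    HasDerivLimit k U (fun x => integralAlong (fun z => E a j x t z * θ z) (bdryD R))
      (integralAlong
          (fun z => Complex.exp (-Complex.I * z ^ 3 * t) * ψ z * nu a (α ^ j * z) ^ k) (bdryD R) +
        integralAlong
          (fun z => Complex.exp (-Complex.I * z ^ 3 * t) * φ z * nu a (α ^ j * z) ^ k)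
          (Gam R ε)) := by
  have hD := isPieceIn_bdryD hR hε.le
  -- Integrability of `φ` on `∂D`, needed for the shift, is inherited from `θ - ψ`.
  have hφ1 : MemLpOn φ 1 (bdryD R) := (hθ1.sub hψ1).congr
    (fun p hp => (hD p hp).measurableSet_dom) fun z hz => by rw [hsum z hz]; ring
  have hmain := (hasDerivLimit_integralAlong hside hR haR hε hD fun m hm =>
    integrableAlong_exp_mul_nu_bdryD hR haR ht hψ1 hψ j (hm.trans hk)).add hside.isOpen
    (hasDerivLimit_integralAlong hside hR haR hε (isPieceIn_Gam hR hε.le) fun m _ =>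
      integrableAlong_exp_mul_nu_Gam hR haR hε ht hφc hφ j m)
  -- The shift is used only at `x ∈ U`, without derivatives; as `U` is open, equality of functions
  -- there passes to all derivatives.
  refine hmain.congr hside.isOpen fun x hx => ?_
  rw [← integralAlong_E_mul_bdryD_eq_Gam hside hR haR hε ht hφ1 hφc hφd hφ hx, ← integralAlong_add]
  · refine integralAlong_congr (fun p hp => (hD p hp).measurableSet_dom) fun z hz => ?_
    rw [hsum z hz]
    ring
  · exact integrableAlong_E_mul hside hR haR hε hD (integrableAlong_exp_mul hR ht hD hψ1) hx
  · exact integrableAlong_E_mul hside hR haR hε hD (integrableAlong_exp_mul hR ht hD hφ1) hx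

end VertexLimit

open VertexLimit in
theorem mainTheorem3 (a R ε : ℝ) (hR : 0 < R) (haR : 4 * |a| ^ 3 < 27 * R ^ 6) (hε : 0 < ε)
    (θ φ ψ : ℂ → ℂ)
    (hθ1 : MemLpOn θ 1 (bdryD R)) (hθi : MemLpOn θ ⊤ (bdryD R))
    (hψ1 : MemLpOn ψ 1 (bdryD R)) (hψi : MemLpOn ψ ⊤ (bdryD R))
    (hsum : ∀ z ∈ trace (bdryD R), θ z = φ z + ψ z)
    (hψ : ψ =O[Bornology.cobounded ℂ ⊓ 𝓟 (trace (bdryD R))] fun z => z ^ (-4 : ℤ))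
    (hφc : ContinuousOn φ (S R ε)) (hφd : DifferentiableOn ℂ φ (interior (S R ε)))
    (hφ : Tendsto (fun C : ℝ => sSup ((fun z => ‖φ z‖) '' {z ∈ S R ε | ‖z‖ = C})) atTop (𝓝 0))
    (k : ℕ) (hk : k ≤ 2) (t : ℝ) (ht : 0 < t) :
    (∀ j : ℕ, j = 1 ∨ j = 2 →
      (∀ x : ℝ, 0 < x → IntegrableAlong (fun z => E a j x t z * θ z) (bdryD R)) ∧
      ContDiffOn ℝ k (fun x : ℝ => integralAlong (fun z => E a j x t z * θ z) (bdryD R)) (Ioi 0) ∧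
      IntegrableAlong
        (fun z => Complex.exp (-Complex.I * z ^ 3 * t) * ψ z * nu a (α ^ j * z) ^ k) (bdryD R) ∧
      IntegrableAlong
        (fun z => Complex.exp (-Complex.I * z ^ 3 * t) * φ z * nu a (α ^ j * z) ^ k) (Gam R ε) ∧
      Tendsto
        (fun x : ℝ => (-Complex.I) ^ k *
          iteratedDeriv k (fun x : ℝ => integralAlong (fun z => E a j x t z * θ z) (bdryD R)) x)
        (𝓝[>] 0)
        (𝓝 (integralAlong
              (fun z => Complex.exp (-Complex.I * z ^ 3 * t) * ψ z * nu a (α ^ j * z) ^ k)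
              (bdryD R) +
            integralAlong
              (fun z => Complex.exp (-Complex.I * z ^ 3 * t) * φ z * nu a (α ^ j * z) ^ k)
              (Gam R ε)))) ∧
    ((∀ x : ℝ, x < 0 → IntegrableAlong (fun z => E a 0 x t z * θ z) (bdryD R)) ∧
      ContDiffOn ℝ k (fun x : ℝ => integralAlong (fun z => E a 0 x t z * θ z) (bdryD R)) (Iio 0) ∧
      IntegrableAlong
        (fun z => Complex.exp (-Complex.I * z ^ 3 * t) * ψ z * nu a z ^ k) (bdryD R) ∧
      IntegrableAlong
        (fun z => Complex.exp (-Complex.I * z ^ 3 * t) * φ z * nu a z ^ k) (Gam R ε) ∧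
      Tendsto
        (fun x : ℝ => (-Complex.I) ^ k *
          iteratedDeriv k (fun x : ℝ => integralAlong (fun z => E a 0 x t z * θ z) (bdryD R)) x)
        (𝓝[<] 0)
        (𝓝 (integralAlong
              (fun z => Complex.exp (-Complex.I * z ^ 3 * t) * ψ z * nu a z ^ k) (bdryD R) +
            integralAlong
              (fun z => Complex.exp (-Complex.I * z ^ 3 * t) * φ z * nu a z ^ k)
              (Gam R ε)))) := by
  have hD := isPieceIn_bdryD hR hε.le
  refine ⟨fun j hj => ?_, ?_⟩
  · have hside : IsDecaySide j (Ioi 0) := Or.inr ⟨hj, rfl⟩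
    obtain ⟨h1, h2⟩ := hasDerivLimit_integralAlong_E hside hR haR hε hθ1 hψ1 hsum hψ hφc hφd hφ hk ht
    exact ⟨fun x hx => integrableAlong_E_mul hside hR haR hε hD
        (integrableAlong_exp_mul hR ht hD hθ1) hx, h1,
      integrableAlong_exp_mul_nu_bdryD hR haR ht hψ1 hψ j hk,
      integrableAlong_exp_mul_nu_Gam hR haR hε ht hφc hφ j k, h2⟩
  · have hside : IsDecaySide 0 (Iio 0) := Or.inl ⟨rfl, rfl⟩
    obtain ⟨h1, h2⟩ := hasDerivLimit_integralAlong_E hside hR haR hε hθ1 hψ1 hsum hψ hφc hφd hφ hk ht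
    have h3 := integrableAlong_exp_mul_nu_bdryD hR haR ht hψ1 hψ 0 hk
    have h4 := integrableAlong_exp_mul_nu_Gam hR haR hε ht hφc hφ 0 k
    simp only [pow_zero, one_mul] at h2 h3 h4
    exact ⟨fun x hx => integrableAlong_E_mul hside hR haR hε hD
      (integrableAlong_exp_mul hR ht hD hθ1) hx, h1, h3, h4, h2⟩
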